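/- **Conventions.** Let $G$ be a group with a finite symmetric generating set $S$, and let $|g|$ be the word length of $g\in G$; set $\rho(x,x') := |x\,x'^{-1}|$. For a group $H$ let $\mathbb{Z}_k^{\oplus H}$ be the finitely supported functions $H\to\mathbb{Z}_k$, on which $H$ acts by coordinate right-translation, $(f^{h})(x) := f(xh^{-1})$. A semidirect product $L\rtimes H$ is the set $L\times H$ with $(\ell_1,h_1)(\ell_2,h_2) := (\ell_1^{h_2}+\ell_2,\,h_1h_2)$. Let $\mathbb{Z}_6\wr G := \mathbb{Z}_6^{\oplus G}\rtimes G$, with generators $(\pm\mathbf{e}_{e_G},e_G)$ and $(\mathbf 0,s)$, $s\in S$. For a subspace $V\le\mathbb{Z}_2^{\oplus(\mathbb{Z}_6\wr G)}$ that is invariant under coordinate right-translation by $\mathbb{Z}_6\wr G$, let $\Gamma_V := (\mathbb{Z}_2^{\oplus (\mathbb{Z}_6\wr G)}/V)\rtimes(\mathbb{Z}_6\wr G)$, with generators $(\delta_{e}+V,e)$ and $(\mathbf 0,s)$, where $s$ runs over the above generators of $\mathbb{Z}_6\wr G$ and $e$ is its identity; let $\rho_{\Gamma_V}$ be the left-invariant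 word metric. For a finite set $T$ let $d_{\mathrm{Ham}}$ be the metric on $\mathbb{Z}_6^T$ that is the sum over the coordinates of the word metric of $\mathbb{Z}_6$ for $\{\pm1\}$. For distinct $\mathcal{A},\mathcal{B}:\mathbb{Z}_6^T\to\mathbb{Z}_2$ let $\mathrm{TS}_{\mathrm{Ham}}(\mathcal{A},\mathcal{B})$ be $1$ plus the least $d_{\mathrm{Ham}}$-length of a cycle that starts and ends at $\mathbf 0$ and covers the support of $\mathcal{A}+\mathcal{B}$; let $\mathrm{TS}_{\mathrm{Ham}}(\mathcal{A},\mathcal{A}):=0$. For a subspace $F$ let $\mathrm{TS}_{\mathrm{Ham}/F}$ be the quotient metric (least distance between members of two cosets). For finite $X$ and a subspace $E\le\mathbb{Z}_2^X$, $E^\perp$ is the orthogonal complement for $\sum_{x\in X} a_xb_x\in\mathbb{Z}_2$. For a map $f:(X,\rho_X)\to(Z,\theta)$, its expansion ratio is $\inf_{u\ne v}\theta(f(u),f(v))/\rho_X(u,v)$, and its distortion is $\sup_{u\neq v}\theta(f(u),f(v))/\rho_X(u,v)\cdot\sup_{u\ne v}\rho_X(u,v)/\theta(f(u),f(v))$ ($+\infty$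 unless $f$ is a bi-Lipschitz embedding). **Scales.** Fix $M\ge1$. Scale data are positive reals $(r_n)_{n\ge1}$, points $(y_n)_{n\ge1}$ of $G$ and pairwise disjoint finite sets $(I_n)_{n\ge1}$ in $G\setminus\{y_1,y_2,\dots\}$ with $r_1<|y_1|<r_2<|y_2|<\cdots$, $|I_n|=10^{r_n}$, $r_n\le\rho(x,x')\le 2Mr_n$ for distinct $x,x'\in I_n$, and $r_n\le|x|\le2Mr_n$ for $x\in I_n$. The sequence of scales $r_1,|y_1|,r_2,|y_2|,\dots$ *grows at least as fast as* $F:\mathbb{R}\to\mathbb{R}$ if $r_1\ge F(0)$, $|y_n|\ge F(r_n)$ and $r_{n+1}\ge F(|y_n|)$ for all $n$. Let $\mathcal{A}:\mathbb{Z}_6\to\mathbb{Z}_2$ be the indicator function of $\{0,1,3,4\}$ and $E_n := I_1\cup\dots\cup I_n\cup\{y_1,\dots,y_n\}$. For $\mathbf u\in\mathbb{Z}_6^{\oplus(G\setminus E_n)}$, $\mathcal{W}\in\mathbb{Z}_2^{\mathbb{Z}_6^{I_n}}$ and $u\in\mathbb{Z}_6$, let $\tilde{\mathcal{Q}}_n(\mathbf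 u,\mathcal{W},u)\in\mathbb{Z}_2^{\oplus(\mathbb{Z}_6\wr G)}$ be the function with value $\delta_{\mathbf u}(\mathbf w|_{G\setminus E_n})\,\mathcal{W}(\mathbf w|_{I_n})\,\mathcal{A}(w_{y_n}-u)$ at $(\mathbf w,e_G)$ and value $0$ at $(\mathbf w,g)$ for $g\neq e_G$. **Proposition.** There is an absolute constant $K>0$ such that for all $G$, $S$, $M$ as above there is $F:\mathbb{R}\to\mathbb{R}$ with the following property. Consider any scale data whose sequence of scales grows at least as fast as $F$, any subspaces $C_n\le\mathbb{Z}_2^{I_n}$ that contain the all-ones vector, and any subspaces $D_n\le\mathbb{Z}_2^{\mathbb{Z}_6^{I_n}}$ that are invariant under the translations of $\mathbb{Z}_6^{I_n}$ and are such that a function $\mathcal{W}$ supported on the basis vectors $\mathbf e_x$, $x\in I_n$, lies in $D_n^\perp$ if and only if $(\mathcal{W}(\mathbf e_x))_{x\in I_n}\in C_n^\perp$. (An example is the space $D_n$ of the functions $\mathbf v\mapsto\eta+\sum_{x\in I_n} a_x v_x \bmod 2$ with $\eta\in\mathbb{Z}_2$, $a\in C_n$.) Then there is a subspace $V\le\mathbb{Z}_2^{\oplus(\mathbb{Z}_6\wr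 G)}$, invariant under coordinate right-translation by $\mathbb{Z}_6\wr G$, such that for every $n$: 1. the map $\psi_n^\circ:\mathbb{Z}_2^{\mathbb{Z}_6^{I_n}}\to\mathbb{Z}_2^{\oplus(\mathbb{Z}_6\wr G)}/V$, $\mathcal{W}\mapsto\tilde{\mathcal{Q}}_n(\mathbf 0,\mathcal{W},0)+V$, is $\mathbb{Z}_2$-linear with kernel exactly $D_n^\perp$; 2. the induced map $\psi_n:\mathbb{Z}_2^{\mathbb{Z}_6^{I_n}}/D_n^\perp\to\Gamma_V$, $\mathcal{W}+D_n^\perp\mapsto(\psi_n^\circ(\mathcal{W}),e)$, is a bi-Lipschitz embedding of $\mathrm{TS}_{\mathrm{Ham}/D_n^\perp}$ into $\rho_{\Gamma_V}$ with distortion at most $KM$ and expansion ratio at most $Kr_n$. -/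

import Mathlib

open scoped ENNReal

noncomputable section

/-! ### Distortion and expansion ratio of maps between spaces with integer-valued metrics -/

/-- The distortion of `f : (X, ρ) → (Z, θ)`: the product of the suprema over `u ≠ v` of
`θ (f u) (f v) / ρ u v` and of `ρ u v / θ (f u) (f v)`; it is `∞` unless `f` is a bi-Lipschitz
embedding. -/
def distortion {X Z : Type*} (ρ : X → X → ℕ) (θ : Z → Z → ℕ) (f : X → Z) : ℝ≥0∞ :=
  open scoped Classical in
  if Function.Injective f then
    (⨆ (u : X) (v : X) (_ : u ≠ v), (θ (f u) (f v) : ℝ≥0∞) / (ρ u v : ℝ≥0∞)) *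
      (⨆ (u : X) (v : X) (_ : u ≠ v), (ρ u v : ℝ≥0∞) / (θ (f u) (f v) : ℝ≥0∞))
  else ⊤

/-- The expansion ratio of `f : (X, ρ) → (Z, θ)`: the infimum over `u ≠ v` of
`θ (f u) (f v) / ρ u v`. -/
def expansionRatio {X Z : Type*} (ρ : X → X → ℕ) (θ : Z → Z → ℕ) (f : X → Z) : ℝ≥0∞ :=
  ⨅ (u : X) (v : X) (_ : u ≠ v), (θ (f u) (f v) : ℝ≥0∞) / (ρ u v : ℝ≥0∞)

/-! ### Word length -/

/-- The length of a shortest word in the alphabet `S` whose value is `g`. -/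
def wordLength {K : Type*} [Group K] (S : Set K) (g : K) : ℕ :=
  sInf {n : ℕ | ∃ l : List K, (∀ s ∈ l, s ∈ S) ∧ l.prod = g ∧ l.length = n}

/-- The left-invariant word metric `|a⁻¹ b|`. -/
def leftWordDist {K : Type*} [Group K] (S : Set K) (a b : K) : ℕ :=
  wordLength S (a⁻¹ * b)

/-- The right-invariant word metric `|a b⁻¹|`. -/
def rightWordDist {K : Type*} [Group K] (S : Set K) (a b : K) : ℕ :=
  wordLength S (a * b⁻¹)

/-! ### Semidirect products -/

/-- The set `L × H`, for a right action `ℓ ↦ ℓ ^ h` of the group `H` on the module `L`, given as a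
linear representation of the opposite group of `H`. -/
@[ext]
structure RightSemidirect {R L H : Type*} [CommRing R] [AddCommGroup L] [Module R L] [Group H]
    (φ : Representation R Hᵐᵒᵖ L) where
  left : L
  right : H

namespace RightSemidirect

variable {R L H : Type*} [CommRing R] [AddCommGroup L] [Module R L] [Group H]
  {φ : Representation R Hᵐᵒᵖ L}

/-- The semidirect product `L ⋊ H`, with the law
`(ℓ₁, h₁) (ℓ₂, h₂) = (ℓ₁ ^ h₂ + ℓ₂, h₁ h₂)`. -/
instance : Group (RightSemidirect φ) where
  mul a b := ⟨φ (MulOpposite.op b.right) a.left + b.left, a.right * b.right⟩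
  one := ⟨0, 1⟩
  inv a := ⟨-φ (MulOpposite.op a.right⁻¹) a.left, a.right⁻¹⟩
  mul_assoc a b c := by
    refine RightSemidirect.ext ?_ (mul_assoc _ _ _)
    change φ (MulOpposite.op c.right) (φ (MulOpposite.op b.right) a.left + b.left) + c.left
      = φ (MulOpposite.op (b.right * c.right)) a.left
        + (φ (MulOpposite.op c.right) b.left + c.left)
    rw [MulOpposite.op_mul, map_mul, map_add, Module.End.mul_apply, add_assoc]
  one_mul a := by
    refine RightSemidirect.ext ?_ (one_mul _)
    change φ (MulOpposite.op a.right) 0 + a.left = a.left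
    rw [map_zero, zero_add]
  mul_one a := by
    refine RightSemidirect.ext ?_ (mul_one _)
    change φ (MulOpposite.op 1) a.left + 0 = a.left
    rw [MulOpposite.op_one, map_one, add_zero, Module.End.one_apply]
  inv_mul_cancel a := by
    refine RightSemidirect.ext ?_ (inv_mul_cancel _)
    change φ (MulOpposite.op a.right) (-φ (MulOpposite.op a.right⁻¹) a.left) + a.left = 0
    rw [map_neg, ← Module.End.mul_apply, ← map_mul, ← MulOpposite.op_mul, inv_mul_cancel,
      MulOpposite.op_one, map_one, Module.End.one_apply, neg_add_cancel]

end RightSemidirect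

/-- Coordinate right-translation: `h` sends the family `(k_x)_x` to `(k_{x h⁻¹})_x`, that is, it
sends the basis vector at `x` to the basis vector at `x h`. -/
def rightTranslation (R H : Type*) [CommRing R] [Group H] : Representation R Hᵐᵒᵖ (H →₀ R) where
  toFun h := Finsupp.lmapDomain R R (fun x => x * h.unop)
  map_one' := by ext; simp
  map_mul' a b := by ext; simp [mul_assoc]

/-- The wreath product `ℤ₆ ≀ G = ℤ₆^{⊕G} ⋊ G`. -/
abbrev Wreath6 (G : Type*) [Group G] := RightSemidirect (rightTranslation (ZMod 6) G)

/-- The generating set `{(± e_{1}, 1)} ∪ {(0, s) : s ∈ S}` of `ℤ₆ ≀ G`. -/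
def wreathGenerators {G : Type*} [Group G] (S : Set G) : Set (Wreath6 G) :=
  {⟨Finsupp.single 1 1, 1⟩, ⟨-Finsupp.single 1 1, 1⟩} ∪ (fun s => ⟨0, s⟩) '' S

/-- Invariance of a subspace of `ℤ₂^{⊕H}` under coordinate right-translation. -/
def RightInvariant {H : Type*} [Group H] (V : Submodule (ZMod 2) (H →₀ ZMod 2)) : Prop :=
  ∀ h : Hᵐᵒᵖ, V ≤ V.comap (rightTranslation (ZMod 2) H h)

/-- The semidirect product `(ℤ₂^{⊕H} / V) ⋊ H` for a right-invariant subspace `V`. -/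
abbrev QuotientWreath {H : Type*} [Group H] (V : Submodule (ZMod 2) (H →₀ ZMod 2))
    (hV : RightInvariant V) :=
  RightSemidirect ((rightTranslation (ZMod 2) H).quotient V hV)

/-- The generating set `{(δ_1 + V, 1)} ∪ {(0, s) : s ∈ S}` of `(ℤ₂^{⊕H} / V) ⋊ H`. -/
def quotientWreathGenerators {H : Type*} [Group H] (V : Submodule (ZMod 2) (H →₀ ZMod 2))
    (hV : RightInvariant V) (S : Set H) : Set (QuotientWreath V hV) :=
  {⟨Submodule.Quotient.mk (Finsupp.single 1 1), 1⟩} ∪ (fun s => ⟨0, s⟩) '' S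

/-! ### Pinned traveling salesman metrics -/

/-- The length `∑ d (x_i, x_{i+1})` of a path given by the list of its points. -/
def pathLength {X : Type*} (d : X → X → ℕ) : List X → ℕ
  | [] => 0
  | [_] => 0
  | x :: x' :: l => d x x' + pathLength d (x' :: l)

/-- The traveling salesman metric pinned at `x₀` on the functions from a finite set `X` to `ℤ₂`:
one plus the least length of a cycle `x₀, x₂, …, x_ℓ, x₀` that covers the support of `A + B`, or
`0` if `A = B`. The list `l` consists of `x₂, …, x_ℓ`. -/
def TS {X : Type*} (d : X → X → ℕ) (x₀ : X) (A B : X → ZMod 2) : ℕ :=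
  open scoped Classical in
  if A = B then 0
  else sInf {n : ℕ | ∃ l : List X, (∀ x, A x + B x ≠ 0 → x ∈ x₀ :: l) ∧
    pathLength d (x₀ :: (l ++ [x₀])) = n} + 1

/-- The quotient of the metric `TS` by a subspace `F`: the distance between two cosets is the least
distance between their members. -/
def TSQuot {X : Type*} (d : X → X → ℕ) (x₀ : X) (F : Submodule (ZMod 2) (X → ZMod 2))
    (P Q : (X → ZMod 2) ⧸ F) : ℕ :=
  sInf {n : ℕ | ∃ A B : X → ZMod 2,
    Submodule.Quotient.mk A = P ∧ Submodule.Quotient.mk B = Q ∧ TS d x₀ A B = n}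

/-- The Hamming metric on `ℤ₆^T`: the sum over the coordinates of the word metric of `ℤ₆` for the
generators `± 1` (`ZMod.valMinAbs` is the representative in `(-3, 3]`). -/
def hammingSix {T : Type*} [Fintype T] (v w : T → ZMod 6) : ℕ :=
  ∑ x, (v x - w x).valMinAbs.natAbs

/-! ### Subspaces of finite-dimensional function spaces -/

/-- The orthogonal complement for the bilinear form `∑ x, W x * V x`. -/
def perp {X : Type*} [Fintype X] (D : Submodule (ZMod 2) (X → ZMod 2)) :
    Submodule (ZMod 2) (X → ZMod 2) where
  carrier := {W | ∀ V ∈ D, ∑ x, W x * V x = 0}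
  add_mem' := by
    intro W W' h h' V hV
    simp only [Pi.add_apply, add_mul, Finset.sum_add_distrib, h V hV, h' V hV, add_zero]
  zero_mem' := by
    intro V _
    simp
  smul_mem' := by
    intro c W h V hV
    simp only [Pi.smul_apply, smul_eq_mul, mul_assoc, ← Finset.mul_sum, h V hV, mul_zero]

/-- Invariance of a subspace of `ℤ₂^{ℤ₆^T}` under the translations of `ℤ₆^T`. -/
def TranslationInvariant {T : Type*} (D : Submodule (ZMod 2) ((T → ZMod 6) → ZMod 2)) : Prop :=
  ∀ u : T → ZMod 6, ∀ W ∈ D, (fun w => W (w - u)) ∈ D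

/-- The functions on `ℤ₆^T` that are supported on the standard basis vectors `e_x` and orthogonal
to `D` are exactly those given by the members of `C^⊥`, under the identification of such a
function `W` with the vector `(W (e_x))_x`. -/
def ExtendsCode {T : Type*} [Fintype T] [DecidableEq T] (C : Submodule (ZMod 2) (T → ZMod 2))
    (D : Submodule (ZMod 2) ((T → ZMod 6) → ZMod 2)) : Prop :=
  ∀ W : (T → ZMod 6) → ZMod 2, (∀ w, W w ≠ 0 → ∃ x, w = Pi.single x 1) →
    (W ∈ perp D ↔ (fun x => W (Pi.single x 1)) ∈ perp C)

/-! ### Scales -/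

/-- The data `(r_n)`, `(I_n)`, `(y_n)` of the construction, indexed from `0`. -/
structure IsScaleData {G : Type*} [Group G] (S : Set G) (M : ℝ) (r : ℕ → ℝ) (I : ℕ → Finset G)
    (y : ℕ → G) : Prop where
  pos : 0 < r 0
  lt_y : ∀ n, r n < (wordLength S (y n) : ℝ)
  y_lt : ∀ n, (wordLength S (y n) : ℝ) < r (n + 1)
  disj : ∀ m n, m ≠ n → Disjoint (I m) (I n)
  y_notMem : ∀ m n, y m ∉ I n
  card : ∀ n, ((I n).card : ℝ) = (10 : ℝ) ^ r n
  le_dist : ∀ n, ∀ x ∈ I n, ∀ x' ∈ I n, x ≠ x' → r n ≤ (rightWordDist S x x' : ℝ)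
  dist_le : ∀ n, ∀ x ∈ I n, ∀ x' ∈ I n, x ≠ x' → (rightWordDist S x x' : ℝ) ≤ 2 * M * r n
  le_length : ∀ n, ∀ x ∈ I n, r n ≤ (wordLength S x : ℝ)
  length_le : ∀ n, ∀ x ∈ I n, (wordLength S x : ℝ) ≤ 2 * M * r n

/-- The sequence of scales `r_0, |y_0|, r_1, |y_1|, …` grows at least as fast as `F` prescribes:
its first term is at least `F 0`, and each further term is at least the value of `F` at the term
before. -/
def ScalesGrow {G : Type*} [Group G] (S : Set G) (F : ℝ → ℝ) (r : ℕ → ℝ) (y : ℕ → G) : Prop :=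
  F 0 ≤ r 0 ∧ (∀ n, F (r n) ≤ (wordLength S (y n) : ℝ)) ∧
    ∀ n, F (wordLength S (y n) : ℝ) ≤ r (n + 1)

/-! ### The maps `Q_n` -/

section Q

variable {G : Type*} [DecidableEq G]

/-- The `ℤ₂`-valued indicator function of `{0, 1, 3, 4} ⊆ ℤ₆`. -/
def indicatorA (a : ZMod 6) : ZMod 2 :=
  if a = 0 ∨ a = 1 ∨ a = 3 ∨ a = 4 then 1 else 0

/-- The finite set `I_0 ∪ ⋯ ∪ I_n ∪ {y_0, …, y_n}`. -/
def scaleSet (I : ℕ → Finset G) (y : ℕ → G) (n : ℕ) : Finset G :=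
  (Finset.range (n + 1)).biUnion fun k => insert (y k) (I k)

/-- The function `Q_n(u, W, c)` on `ℤ₆^{⊕G}`. -/
def Q (I : ℕ → Finset G) (y : ℕ → G) (n : ℕ) (u : {g : G // g ∉ scaleSet I y n} →₀ ZMod 6)
    (W : (I n → ZMod 6) → ZMod 2) (c : ZMod 6) (w : G →₀ ZMod 6) : ZMod 2 :=
  open scoped Classical in
  (if ∀ g : {g : G // g ∉ scaleSet I y n}, w g = u g then 1 else 0) *
    W (fun x => w x) * indicatorA (w (y n) - c)

theorem Q_support_finite (I : ℕ → Finset G) (y : ℕ → G) (n : ℕ)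
    (u : {g : G // g ∉ scaleSet I y n} →₀ ZMod 6) (W : (I n → ZMod 6) → ZMod 2) (c : ZMod 6) :
    {w : G →₀ ZMod 6 | Q I y n u W c w ≠ 0}.Finite := by
  refine Set.Finite.of_finite_image (f := fun w (x : scaleSet I y n) => w x) (Set.toFinite _) ?_
  intro w hw w' hw' h
  have key : ∀ v : G →₀ ZMod 6, Q I y n u W c v ≠ 0 →
      ∀ g : {g : G // g ∉ scaleSet I y n}, v g = u g := by
    intro v hv
    by_contra hne
    exact hv (by simp only [Q, if_neg hne, zero_mul])
  ext g
  by_cases hg : g ∈ scaleSet I y n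
  · exact congrFun h ⟨g, hg⟩
  · rw [key w hw ⟨g, hg⟩, key w' hw' ⟨g, hg⟩]

/-- The extension of `Q_n(u, W, c)` by zero from the zero section to `ℤ₆ ≀ G`. -/
def Qtilde [Group G] (I : ℕ → Finset G) (y : ℕ → G) (n : ℕ) (u : {g : G // g ∉ scaleSet I y n} →₀ ZMod 6)
    (W : (I n → ZMod 6) → ZMod 2) (c : ZMod 6) : Wreath6 G →₀ ZMod 2 :=
  Finsupp.ofSupportFinite
    (fun h => if h.right = 1 then Q I y n u W c h.left else 0)
    (((Q_support_finite I y n u W c).image fun w => (⟨w, 1⟩ : Wreath6 G)).subset (by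
      intro h hh
      rw [Function.mem_support] at hh
      by_cases h1 : h.right = 1
      · rw [if_pos h1] at hh
        exact ⟨h.left, hh, RightSemidirect.ext rfl h1.symm⟩
      · exact absurd (if_neg h1) hh))

end Q

end

/-! The space `V` is cut out by linear tests. Each scale `n` has a weight `ψ n` on lamp
configurations, and `detect` multiplies a function on the zero section by this weight and pushes it
forward to the configurations on `I n`. `V` consists of the functions all of whose translates are
sent into `perp (D n)` by every test, which makes it right-invariant.

The scales do not interfere, because `{0, 1, 3, 4}` is the preimage of two residues mod 3 and `{0,
1, 2}` is a transversal mod 3: every translate of the former meets the latter in exactly two points.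
Hence a factor `{0, 1, 2}` of `ψ n` at `y m` annihilates all translates of the functions of scale `m
≠ n`. The test `n` sends the function of scale `n` built from `W` back to `W`, and its translates to
sums of translates of `W`. As `D n` is translation-invariant, the kernel is exactly `perp (D n)`.

For the upper bound, the point `y n` is too far away to be visited. Just inside the sphere of radius
`r n` there is an anchor `c n` that avoids the sets of all scales. The weight `ψ n` sees the lamps
at `y n` and `c n` only through their sum, and the other weights annihilate blocks at either point.
So, modulo `V`, the lamp at `y n` may be replaced by one at `c n`, at a cost of order `r n`. The
growth of the scales makes all earlier scales cost at most `r n`. A Hamming step on `I n` costs at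
most of order `M * r n`.

For the lower bound, changing lamps at two different members of `I n` takes `r n` moves in between,
so a word of length `ℓ` yields a Hamming tour of length at most `3 + 9 ℓ / r n`
(`exists_walk_of_word`). The additive constant is absorbed because `ψ n` vanishes unless the lamp at
`y n` or `c n` is lit (`ne_zero_of_profile_ne_zero`), which forces `ℓ ≥ r n - 1`. -/

/-! ### Words and word length -/

/-- `g` is the value of a word of length at most `n` in the alphabet `S`. -/
def HasWord {K : Type*} [Group K] (S : Set K) (g : K) (n : ℕ) : Prop :=
  ∃ l : List K, (∀ s ∈ l, s ∈ S) ∧ l.prod = g ∧ l.length ≤ n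

namespace HasWord

variable {K : Type*} [Group K] {S : Set K} {g h : K} {m n : ℕ}

theorem mono (hg : HasWord S g m) (hmn : m ≤ n) : HasWord S g n := by
  obtain ⟨l, h1, h2, h3⟩ := hg
  exact ⟨l, h1, h2, h3.trans hmn⟩

theorem one : HasWord S 1 n := ⟨[], by simp, by simp, by simp⟩

theorem of_mem (hg : g ∈ S) : HasWord S g 1 := ⟨[g], by simpa using hg, by simp, by simp⟩

theorem mul (hg : HasWord S g m) (hh : HasWord S h n) : HasWord S (g * h) (m + n) := by
  obtain ⟨l, h1, h2, h3⟩ := hg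
  obtain ⟨l', h1', h2', h3'⟩ := hh
  refine ⟨l ++ l', ?_, by simp [h2, h2'], by simp; omega⟩
  intro s hs
  rcases List.mem_append.1 hs with hs | hs
  · exact h1 s hs
  · exact h1' s hs

theorem pow (hg : HasWord S g m) (k : ℕ) : HasWord S (g ^ k) (k * m) := by
  induction k with
  | zero => simpa using one
  | succ k ih => rw [pow_succ, Nat.succ_mul]; exact ih.mul hg

theorem inv (hS : ∀ s ∈ S, s⁻¹ ∈ S) (hg : HasWord S g n) : HasWord S g⁻¹ n := by
  obtain ⟨l, h1, h2, h3⟩ := hg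
  refine ⟨(l.map fun x => x⁻¹).reverse, ?_, ?_, by simpa using h3⟩
  · intro s hs
    simp only [List.mem_reverse, List.mem_map] at hs
    obtain ⟨a, ha, rfl⟩ := hs
    exact hS a (h1 a ha)
  · rw [← h2, List.prod_inv_reverse]

theorem wordLength_le (hg : HasWord S g n) : wordLength S g ≤ n := by
  obtain ⟨l, h1, h2, h3⟩ := hg
  unfold wordLength
  exact le_trans (Nat.sInf_le ⟨l, h1, h2, rfl⟩) h3

/-- The existence of some word matters: without one, `wordLength` is the infimum of the empty set,
which is `0` and not attained. -/
theorem exists_list (hg : HasWord S g n) :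
    ∃ l : List K, (∀ s ∈ l, s ∈ S) ∧ l.prod = g ∧ l.length = wordLength S g := by
  obtain ⟨l, h1, h2, h3⟩ := hg
  exact Nat.sInf_mem (s := {n : ℕ | ∃ l : List K, (∀ s ∈ l, s ∈ S) ∧ l.prod = g ∧ l.length = n})
    ⟨_, l, h1, h2, rfl⟩

theorem shortest (hg : HasWord S g n) : HasWord S g (wordLength S g) := by
  obtain ⟨l, h1, h2, h3⟩ := hg.exists_list
  exact ⟨l, h1, h2, h3.le⟩

theorem map {K' : Type*} [Group K'] {S' : Set K'} (f : K →* K') (hf : ∀ s ∈ S, f s ∈ S')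
    (hg : HasWord S g n) : HasWord S' (f g) n := by
  obtain ⟨l, h1, h2, h3⟩ := hg
  refine ⟨l.map f, ?_, by rw [← h2, map_list_prod], by simpa using h3⟩
  intro s hs
  obtain ⟨a, ha, rfl⟩ := List.mem_map.1 hs
  exact hf a (h1 a ha)

end HasWord

section Generated

variable {G : Type*} [Group G] {S : Finset G}

theorem hasWord_wordLength (hS : ∀ s ∈ S, s⁻¹ ∈ S) (hgen : Subgroup.closure (S : Set G) = ⊤)
    (g : G) : HasWord (S : Set G) g (wordLength (S : Set G) g) := by
  have hg : g ∈ (Subgroup.closure (S : Set G)).toSubmonoid := by rw [hgen]; trivial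
  rw [Subgroup.closure_toSubmonoid] at hg
  obtain ⟨l, h1, h2⟩ := Submonoid.exists_list_of_mem_closure hg
  refine HasWord.shortest (n := l.length) ⟨l, ?_, h2, le_rfl⟩
  intro s hs
  rcases h1 s hs with h | h
  · exact h
  · simpa using hS _ (Set.mem_inv.1 h)

theorem wordLength_one {K : Type*} [Group K] (S : Set K) : wordLength S (1 : K) = 0 :=
  Nat.le_zero.1 (HasWord.wordLength_le HasWord.one)

theorem wordLength_mul_le (hS : ∀ s ∈ S, s⁻¹ ∈ S) (hgen : Subgroup.closure (S : Set G) = ⊤)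
    (g h : G) : wordLength (S : Set G) (g * h) ≤
      wordLength (S : Set G) g + wordLength (S : Set G) h :=
  ((hasWord_wordLength hS hgen g).mul (hasWord_wordLength hS hgen h)).wordLength_le

/-- Prefixes of a shortest word realize all smaller lengths. -/
theorem exists_wordLength_eq (hS : ∀ s ∈ S, s⁻¹ ∈ S) (hgen : Subgroup.closure (S : Set G) = ⊤)
    (g : G) {k : ℕ} (hk : k ≤ wordLength (S : Set G) g) :
    ∃ g' : G, wordLength (S : Set G) g' = k := by
  obtain ⟨l, h1, h2, h3⟩ := (hasWord_wordLength hS hgen g).exists_list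
  refine ⟨(l.take k).prod, le_antisymm ?_ ?_⟩
  · exact HasWord.wordLength_le ⟨l.take k, fun s hs => h1 s (List.mem_of_mem_take hs), rfl, by simp⟩
  · have hd : wordLength (S : Set G) (l.drop k).prod ≤ l.length - k :=
      HasWord.wordLength_le ⟨l.drop k, fun s hs => h1 s (List.mem_of_mem_drop hs), rfl, by simp⟩
    have := wordLength_mul_le hS hgen (l.take k).prod (l.drop k).prod
    rw [List.prod_take_mul_prod_drop, h2] at this
    omega

theorem finite_ball (hS : ∀ s ∈ S, s⁻¹ ∈ S) (hgen : Subgroup.closure (S : Set G) = ⊤) (n : ℕ) :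
    {g : G | wordLength (S : Set G) g ≤ n}.Finite := by
  have hfin : {l : List S | l.length ≤ n}.Finite := List.finite_length_le S n
  refine (hfin.image fun l => (l.map Subtype.val).prod).subset ?_
  intro g hg
  obtain ⟨l, h1, h2, h3⟩ := (hasWord_wordLength hS hgen g).exists_list
  refine ⟨l.attach.map fun s => ⟨s.1, h1 s.1 s.2⟩, ?_, ?_⟩
  · simpa [h3] using hg
  · simpa [List.map_map, Function.comp_def] using h2

end Generated

/-! ### Coordinates in semidirect products and translation of point masses -/

namespace RightSemidirect

variable {R L H : Type*} [CommRing R] [AddCommGroup L] [Module R L] [Group H]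
  {φ : Representation R Hᵐᵒᵖ L} (a b : RightSemidirect φ)

theorem mul_left : (a * b).left = φ (MulOpposite.op b.right) a.left + b.left := rfl

theorem mul_right : (a * b).right = a.right * b.right := rfl

theorem one_left : (1 : RightSemidirect φ).left = 0 := rfl

theorem one_right : (1 : RightSemidirect φ).right = 1 := rfl

theorem inv_left : a⁻¹.left = -φ (MulOpposite.op a.right⁻¹) a.left := rfl

theorem inv_right : a⁻¹.right = a.right⁻¹ := rfl

end RightSemidirect

theorem rightTranslation_single {R H : Type*} [CommRing R] [Group H] (h x : H) (a : R) :
    rightTranslation R H (MulOpposite.op h) (Finsupp.single x a) = Finsupp.single (x * h) a := by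
  simp [rightTranslation, Finsupp.lmapDomain_apply, Finsupp.mapDomain_single]

theorem rightTranslation_mul {R H : Type*} [CommRing R] [Group H] (h k : H) (f : H →₀ R) :
    rightTranslation R H (MulOpposite.op k) (rightTranslation R H (MulOpposite.op h) f) =
      rightTranslation R H (MulOpposite.op (h * k)) f := by
  rw [MulOpposite.op_mul, map_mul, Module.End.mul_apply]

/-- Extension by zero of a function on a finite set. -/
noncomputable def extendZero {G : Type*} [DecidableEq G] (T : Finset G) :
    (T → ZMod 6) →+ (G →₀ ZMod 6) where
  toFun v := Finsupp.onFinset T (fun g => if h : g ∈ T then v ⟨g, h⟩ else 0) (by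
    intro a ha
    by_contra h
    simp [h] at ha)
  map_zero' := by ext g; simp
  map_add' v w := by
    ext g
    by_cases h : g ∈ T <;> simp [h]

/-- Restriction to a finite set. -/
def restrictTo {G : Type*} (T : Finset G) : (G →₀ ZMod 6) →+ (T → ZMod 6) where
  toFun w x := w x
  map_zero' := rfl
  map_add' _ _ := rfl

theorem restrictTo_apply {G : Type*} (T : Finset G) (w : G →₀ ZMod 6) (x : T) :
    restrictTo T w x = w x := rfl

/-! ### Lamp configurations on a finite set -/

section extendZero

variable {G : Type*} [DecidableEq G] {T : Finset G}

theorem extendZero_of_mem (v : T → ZMod 6) {g : G} (hg : g ∈ T) :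
    extendZero T v g = v ⟨g, hg⟩ := by
  simp [extendZero, hg]

theorem extendZero_of_notMem (v : T → ZMod 6) {g : G} (hg : g ∉ T) : extendZero T v g = 0 := by
  simp [extendZero, hg]

theorem extendZero_coe (v : T → ZMod 6) (g : T) : extendZero T v g = v g :=
  extendZero_of_mem v g.2

theorem extendZero_eq_sum (v : T → ZMod 6) :
    extendZero T v = ∑ x : T, Finsupp.single (x : G) (v x) := by
  ext g
  rw [Finsupp.finsetSum_apply]
  by_cases hg : g ∈ T
  · rw [extendZero_of_mem v hg, Finset.sum_eq_single ⟨g, hg⟩]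
    · simp
    · intro b _ hb
      exact Finsupp.single_eq_of_ne fun h => hb (Subtype.ext h.symm)
    · simp
  · rw [extendZero_of_notMem v hg, Finset.sum_eq_zero]
    intro b _
    exact Finsupp.single_eq_of_ne fun h => hg (h ▸ b.2)

end extendZero

/-! ### The sets of the earlier scales -/

section Scales

variable {G : Type*} [DecidableEq G]

/-- The set of the scales below the `n`th one. -/
def lowerSet (I : ℕ → Finset G) (y : ℕ → G) (n : ℕ) : Finset G :=
  (Finset.range n).biUnion fun k => insert (y k) (I k)

theorem mem_lowerSet {I : ℕ → Finset G} {y : ℕ → G} {n : ℕ} {g : G} :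
    g ∈ lowerSet I y n ↔ ∃ k < n, g = y k ∨ g ∈ I k := by
  simp [lowerSet]

theorem mem_scaleSet {I : ℕ → Finset G} {y : ℕ → G} {n : ℕ} {g : G} :
    g ∈ scaleSet I y n ↔ g ∈ lowerSet I y n ∨ g = y n ∨ g ∈ I n := by
  simp only [scaleSet, lowerSet, Finset.range_add_one, Finset.biUnion_insert, Finset.mem_union,
    Finset.mem_insert]
  tauto

theorem eq_configuration_iff {L I : Finset G} {c : G} (hLI : Disjoint L I) (hcL : c ∉ L)
    (hcI : c ∉ I) (w : G →₀ ZMod 6) (z : L → ZMod 6) (a : ZMod 6) (v : I → ZMod 6) :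
    extendZero L z + Finsupp.single c a + extendZero I v = w ↔
      ((∀ g, g ∉ L → g ≠ c → g ∉ I → w g = 0) ∧ a = w c) ∧
        z = restrictTo L w ∧ v = restrictTo I w := by
  constructor
  · rintro rfl
    refine ⟨⟨fun g h1 h2 h3 => ?_, ?_⟩, ?_, ?_⟩
    · simp [extendZero_of_notMem, h1, h2, h3]
    · simp [extendZero_of_notMem, hcL, hcI]
    · ext x
      have h1 : (x : G) ≠ c := fun h => hcL (h ▸ x.2)
      have h2 : (x : G) ∉ I := Finset.disjoint_left.1 hLI x.2
      simp [restrictTo_apply, extendZero_coe, extendZero_of_notMem, h1, h2]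
    · ext x
      have h1 : (x : G) ≠ c := fun h => hcI (h ▸ x.2)
      have h2 : (x : G) ∉ L := Finset.disjoint_right.1 hLI x.2
      simp [restrictTo_apply, extendZero_coe, extendZero_of_notMem, h1, h2]
  · rintro ⟨⟨h, rfl⟩, rfl, rfl⟩
    ext g
    by_cases h1 : g ∈ L
    · have h2 : g ≠ c := fun h => hcL (h ▸ h1)
      have h3 : g ∉ I := Finset.disjoint_left.1 hLI h1
      simp [restrictTo_apply, extendZero_of_mem, extendZero_of_notMem, h1, h2, h3]
    · by_cases h2 : g = c
      · subst h2
        simp [extendZero_of_notMem, hcL, hcI]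
      · by_cases h3 : g ∈ I
        · simp [restrictTo_apply, extendZero_of_mem, extendZero_of_notMem, h1, h2, h3]
        · simp [extendZero_of_notMem, h1, h2, h3, h g h1 h2 h3]

end Scales

/-- The set `{0, 1, 3, 4} ⊆ ℤ₆`. -/
def supportA : Finset (ZMod 6) := {0, 1, 3, 4}

theorem indicatorA_eq (a : ZMod 6) : indicatorA a = if a ∈ supportA then 1 else 0 := by
  simp [indicatorA, supportA]

/-! ### Blocks and their translates -/

section Lamp

variable {G : Type*} [Group G]

/-- The element `(w, 1)` of `ℤ₆ ≀ G`. -/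
def lamp (w : G →₀ ZMod 6) : Wreath6 G := ⟨w, 1⟩

theorem lamp_mul (w : G →₀ ZMod 6) (h : Wreath6 G) (hh : h.right = 1) :
    lamp w * h = lamp (w + h.left) := by
  refine RightSemidirect.ext ?_ ?_
  · rw [RightSemidirect.mul_left, hh, MulOpposite.op_one, map_one]; rfl
  · rw [RightSemidirect.mul_right, hh]; exact mul_one _

theorem lamp_add (w w' : G →₀ ZMod 6) : lamp (w + w') = lamp w * lamp w' :=
  (lamp_mul w (lamp w') rfl).symm

theorem lamp_zero : lamp (0 : G →₀ ZMod 6) = 1 := rfl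

variable [DecidableEq G]

/-- The sum of the point masses at the lamp configurations that are arbitrary on `L`, take a value
in `{0, 1, 3, 4}` at `c` and vanish elsewhere. -/
noncomputable def block (L : Finset G) (c : G) : Wreath6 G →₀ ZMod 2 :=
  ∑ z : L → ZMod 6, ∑ a ∈ supportA,
    Finsupp.single (lamp (extendZero L z + Finsupp.single c a)) 1

/-- The combination of translates of a block prescribed by a function of the lamps in `I`. -/
noncomputable def lampSum (L I : Finset G) (c : G) :
    ((I → ZMod 6) → ZMod 2) →ₗ[ZMod 2] (Wreath6 G →₀ ZMod 2) :=
  ∑ v : I → ZMod 6, (LinearMap.proj v : ((I → ZMod 6) → ZMod 2) →ₗ[ZMod 2] ZMod 2).smulRight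
    (rightTranslation (ZMod 2) (Wreath6 G) (MulOpposite.op (lamp (extendZero I v))) (block L c))

theorem lampSum_apply (L I : Finset G) (c : G) (W : (I → ZMod 6) → ZMod 2) :
    lampSum L I c W = ∑ v : I → ZMod 6, W v •
      rightTranslation (ZMod 2) (Wreath6 G) (MulOpposite.op (lamp (extendZero I v)))
        (block L c) := by
  simp [lampSum]

theorem lampSum_eq (L I : Finset G) (c : G) (W : (I → ZMod 6) → ZMod 2) :
    lampSum L I c W = ∑ v : I → ZMod 6, ∑ z : L → ZMod 6, ∑ a ∈ supportA, W v •
      Finsupp.single (lamp (extendZero L z + Finsupp.single c a + extendZero I v)) 1 := by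
  rw [lampSum_apply]
  refine Finset.sum_congr rfl fun v _ => ?_
  simp only [block, map_sum, rightTranslation_single, ← lamp_add, Finset.smul_sum]

/-- This form separates the tour on `I n` from a fixed block, and leaves the point `c` free, so that
`y n` can later be exchanged for an anchor. -/
theorem Qtilde_eq_lampSum (I : ℕ → Finset G) (y : ℕ → G) (n : ℕ) (W : (I n → ZMod 6) → ZMod 2)
    (hLI : Disjoint (lowerSet I y n) (I n)) (hyL : y n ∉ lowerSet I y n) (hyI : y n ∉ I n) :
    Qtilde I y n 0 W 0 = lampSum (lowerSet I y n) (I n) (y n) W := by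
  classical
  ext ⟨w, g⟩
  rw [lampSum_eq]
  simp only [Qtilde, Finsupp.ofSupportFinite_coe, Finsupp.finsetSum_apply, Finsupp.smul_apply,
    smul_eq_mul, Finsupp.single_apply]
  by_cases hg : g = 1
  · subst hg
    have key : ∀ (z : lowerSet I y n → ZMod 6) (a : ZMod 6) (v : I n → ZMod 6),
        lamp (extendZero (lowerSet I y n) z + Finsupp.single (y n) a + extendZero (I n) v) = ⟨w, 1⟩ ↔
      ((∀ g, g ∉ lowerSet I y n → g ≠ y n → g ∉ I n → w g = 0) ∧ a = w (y n)) ∧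
        z = restrictTo (lowerSet I y n) w ∧ v = restrictTo (I n) w := by
      intro z a v
      rw [← eq_configuration_iff hLI hyL hyI]
      exact ⟨fun h => congrArg RightSemidirect.left h, fun h => by rw [h]; rfl⟩
    have hout : (∀ g : {g : G // g ∉ scaleSet I y n}, w g = 0) ↔
        ∀ g, g ∉ lowerSet I y n → g ≠ y n → g ∉ I n → w g = 0 := by
      constructor
      · intro h g h1 h2 h3
        exact h ⟨g, by rw [mem_scaleSet]; tauto⟩
      · rintro h ⟨g, hg⟩
        rw [mem_scaleSet] at hg
        push Not at hg
        exact h g hg.1 hg.2.1 hg.2.2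
    simp only [key, if_true, Q, Finsupp.coe_zero, Pi.zero_apply, hout, sub_zero, indicatorA_eq]
    rw [Finset.sum_eq_single (restrictTo (I n) w), Finset.sum_eq_single (restrictTo (lowerSet I y n) w)]
    · by_cases h1 : ∀ g, g ∉ lowerSet I y n → g ≠ y n → g ∉ I n → w g = 0
      · have hW : (W fun x => w x) = W (restrictTo (I n) w) := rfl
        simp only [eq_true h1, hW, true_and, and_true, if_true, one_mul, mul_ite, mul_one, mul_zero,
          Finset.sum_ite_eq']
      · simp [h1]
    · intro z _ hz
      simp [hz]
    · simp
    · intro v _ hv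
      simp [hv]
    · simp
  · rw [if_neg hg]
    symm
    refine Finset.sum_eq_zero fun v _ => Finset.sum_eq_zero fun z _ => Finset.sum_eq_zero fun a _ => ?_
    rw [if_neg, mul_zero]
    exact fun h => hg (congrArg RightSemidirect.right h).symm

end Lamp

/-! ### The weights on lamp configurations -/

section Profile

variable {G : Type*} [DecidableEq G] (I : Finset G) (c c' : G) (Y : Set G)

open scoped Classical in
/-- The factor at the coordinate `g` of the weight `profile`: constant on `I ∪ {c, c'}`, the
indicator of `{0, 1, 2}` on the rest of `Y` and the indicator of `0` elsewhere. -/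
noncomputable def profileFactor (g : G) (a : ZMod 6) : ZMod 2 :=
  if g ∈ I ∨ g = c ∨ g = c' then 1
  else if g ∈ Y then (if a = 0 ∨ a = 1 ∨ a = 2 then 1 else 0)
  else if a = 0 then 1 else 0

/-- A weight on lamp configurations that is annihilated by `{0, 1, 3, 4}` at the members of `Y`,
does not see the lamps in `I`, and sees the lamps at `c` and `c'` only through their sum. -/
noncomputable def profile (w : G →₀ ZMod 6) : ZMod 2 :=
  if w c + w c' = 1 then w.prod (profileFactor I c c' Y) else 0

variable {I c c' Y}

theorem profileFactor_zero (g : G) : profileFactor I c c' Y g 0 = 1 := by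
  simp [profileFactor]

theorem Finsupp.prod_congr_of_forall {α M N : Type*} [Zero M] [CommMonoid N] {f f' : α →₀ M}
    {p : α → M → N} (h0 : ∀ x, p x 0 = 1) (h : ∀ x, p x (f x) = p x (f' x)) :
    f.prod p = f'.prod p := by
  classical
  rw [Finsupp.prod_of_support_subset f (Finset.subset_union_left (s₂ := f'.support)) p
    fun x _ => h0 x, Finsupp.prod_of_support_subset f' (Finset.subset_union_right (s₁ := f.support))
    p fun x _ => h0 x]
  exact Finset.prod_congr rfl fun x _ => h x

theorem sum_supportA_indicator (b : ZMod 6) :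
    ∑ a ∈ supportA, (if b + a = 0 ∨ b + a = 1 ∨ b + a = 2 then 1 else 0 : ZMod 2) = 0 := by
  revert b
  decide

/-- The factor at `x` splits off the product, and its four values cancel mod 2. This is what makes
the test of one scale blind to the others. -/
theorem sum_supportA_profile {x : G} (hxI : x ∉ I) (hxc : x ≠ c) (hxc' : x ≠ c') (hxY : x ∈ Y)
    (w : G →₀ ZMod 6) : ∑ a ∈ supportA, profile I c c' Y (w + Finsupp.single x a) = 0 := by
  have key : ∀ a, profile I c c' Y (w + Finsupp.single x a) =
      (if w x + a = 0 ∨ w x + a = 1 ∨ w x + a = 2 then 1 else 0) *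
        (if w c + w c' = 1 then (w.erase x).prod (profileFactor I c c' Y) else 0) := by
    intro a
    have h1 : (w + Finsupp.single x a) c = w c := by simp [hxc.symm]
    have h2 : (w + Finsupp.single x a) c' = w c' := by simp [hxc'.symm]
    rw [profile, h1, h2]
    split_ifs with h3 h4
    all_goals
      try rw [← Finsupp.mul_prod_erase' _ x _ fun g => profileFactor_zero g]
      simp [profileFactor, *]
  simp only [key, ← Finset.sum_mul, sum_supportA_indicator, zero_mul]

theorem profile_congr {w w' : G →₀ ZMod 6} (hsum : w c + w c' = w' c + w' c')
    (h : ∀ g, g ∉ I → g ≠ c → g ≠ c' → w g = w' g) :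
    profile I c c' Y w = profile I c c' Y w' := by
  rw [profile, profile, hsum, Finsupp.prod_congr_of_forall profileFactor_zero]
  intro g
  by_cases hg : g ∈ I ∨ g = c ∨ g = c'
  · simp [profileFactor, hg]
  · push Not at hg
    rw [h g hg.1 hg.2.1 hg.2.2]

theorem profile_add_single (w : G →₀ ZMod 6) (a : ZMod 6) :
    profile I c c' Y (w + Finsupp.single c a) = profile I c c' Y (w + Finsupp.single c' a) := by
  refine profile_congr ?_ fun g _ h1 h2 => by simp [h1, h2]
  by_cases h : c = c'
  · rw [h]
  · simp [h, Ne.symm h]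
    ring

theorem profile_add_extendZero (hc : c ∉ I) (hc' : c' ∉ I) (w : G →₀ ZMod 6) (v : I → ZMod 6) :
    profile I c c' Y (w + extendZero I v) = profile I c c' Y w := by
  refine profile_congr ?_ fun g h1 _ _ => ?_
  · simp [extendZero_of_notMem, hc, hc']
  · simp [extendZero_of_notMem, h1]

/-- The prescribed sum `1` is nonzero. A configuration seen by the test thus has a lit lamp far from
the identity, which bounds word lengths from below. -/
theorem ne_zero_of_profile_ne_zero {w : G →₀ ZMod 6} (h : profile I c c' Y w ≠ 0) :
    w c ≠ 0 ∨ w c' ≠ 0 := by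
  by_contra! h0
  simp [profile, h0] at h
  exact absurd h.1 (by decide)

/-- The sum factors over the coordinates. At `c` only the value `1` meets the sum condition, and
each coordinate in `L` contributes three admissible values or one, an odd number in either case. -/
theorem sum_profile {L : Finset G} (hLI : Disjoint L I) (hcL : c ∉ L) (hcL' : c' ∉ L)
    (hcc : c ≠ c') :
    ∑ z : L → ZMod 6, ∑ a ∈ supportA,
      profile I c c' Y (extendZero L z + Finsupp.single c a) = 1 := by
  have key : ∀ (z : L → ZMod 6) (a : ZMod 6),
      profile I c c' Y (extendZero L z + Finsupp.single c a) =
        (if a = 1 then 1 else 0) * ∏ g : L, profileFactor I c c' Y g (z g) := by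
    intro z a
    have h1 : (extendZero L z + Finsupp.single c a) c +
        (extendZero L z + Finsupp.single c a) c' = a := by
      simp [extendZero_of_notMem, hcL, hcL', hcc.symm]
    rw [profile, h1, ite_mul, one_mul, zero_mul]
    congr 1
    rw [Finsupp.prod_congr_of_forall (f' := extendZero L z) profileFactor_zero,
      Finsupp.prod_of_support_subset (s := L), ← Finset.prod_coe_sort]
    · exact Finset.prod_congr rfl fun g _ => by rw [extendZero_coe]
    · intro g hg
      by_contra h
      exact (Finsupp.mem_support_iff.1 hg) (extendZero_of_notMem z h)
    · exact fun g _ => profileFactor_zero g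
    · intro g
      by_cases hg : g = c
      · simp [profileFactor, hg]
      · simp [hg]
  simp only [key]
  simp only [← Finset.sum_mul, ← Finset.mul_sum]
  have h1 : ∑ a ∈ supportA, (if a = 1 then 1 else 0 : ZMod 2) = 1 := by decide
  rw [h1, one_mul, ← Fintype.prod_sum fun (g : L) (a : ZMod 6) => profileFactor I c c' Y g a]
  refine Finset.prod_eq_one fun g _ => ?_
  have hg : ¬ ((g : G) ∈ I ∨ (g : G) = c ∨ (g : G) = c') := by
    rintro (h | h | h)
    · exact Finset.disjoint_left.1 hLI g.2 h
    · exact hcL (h ▸ g.2)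
    · exact hcL' (h ▸ g.2)
  simp only [profileFactor, hg, if_false]
  split_ifs <;> decide

end Profile

/-! ### The tests and the subspace they define -/

section Detect

variable {G : Type*} [Group G] [DecidableEq G]

/-- The linear map to functions on `ℤ₆^I` that sends the point mass at `(w, 1)` to `ψ w` times the
point mass at `w|_I`, and the point mass at `(w, g)` to `0` for `g ≠ 1`. -/
noncomputable def detect (I : Finset G) (ψ : (G →₀ ZMod 6) → ZMod 2) :
    (Wreath6 G →₀ ZMod 2) →ₗ[ZMod 2] ((I → ZMod 6) → ZMod 2) :=
  Finsupp.linearCombination (ZMod 2) fun h : Wreath6 G =>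
    if h.right = 1 then Pi.single (restrictTo I h.left) (ψ h.left) else 0

variable {I : Finset G} {ψ : (G →₀ ZMod 6) → ZMod 2}

theorem detect_single (h : Wreath6 G) :
    detect I ψ (Finsupp.single h 1) =
      if h.right = 1 then Pi.single (restrictTo I h.left) (ψ h.left) else 0 := by
  rw [detect, Finsupp.linearCombination_single, one_smul]

theorem detect_translate_lampSum (L J : Finset G) (c : G) (W : (J → ZMod 6) → ZMod 2)
    (k : Wreath6 G) :
    detect I ψ (rightTranslation (ZMod 2) (Wreath6 G) (MulOpposite.op k) (lampSum L J c W)) =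
      if k.right = 1 then ∑ v : J → ZMod 6, ∑ z : L → ZMod 6, ∑ a ∈ supportA, W v •
        Pi.single (restrictTo I (extendZero L z + Finsupp.single c a + extendZero J v + k.left))
          (ψ (extendZero L z + Finsupp.single c a + extendZero J v + k.left))
      else 0 := by
  simp only [lampSum_eq, map_sum, map_smul, rightTranslation_single, detect_single]
  split_ifs with hk
  · refine Finset.sum_congr rfl fun v _ => Finset.sum_congr rfl fun z _ =>
      Finset.sum_congr rfl fun a _ => ?_
    rw [lamp_mul _ _ hk]
    exact congrArg _ (if_pos rfl)
  · refine Finset.sum_eq_zero fun v _ => Finset.sum_eq_zero fun z _ =>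
      Finset.sum_eq_zero fun a _ => ?_
    rw [if_neg, smul_zero]
    rwa [RightSemidirect.mul_right, lamp, one_mul]

/-- Since `c ∉ I`, the four configurations that differ at `c` have the same restriction to `I`, so
their weights add up at one point and cancel. -/
theorem detect_translate_lampSum_eq_zero {L J : Finset G} {c : G} (hc : c ∉ I)
    (hψ : ∀ w, ∑ a ∈ supportA, ψ (w + Finsupp.single c a) = 0) (W : (J → ZMod 6) → ZMod 2)
    (k : Wreath6 G) :
    detect I ψ (rightTranslation (ZMod 2) (Wreath6 G) (MulOpposite.op k) (lampSum L J c W)) = 0 := by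
  rw [detect_translate_lampSum]
  split_ifs
  · refine Finset.sum_eq_zero fun v _ => Finset.sum_eq_zero fun z _ => ?_
    rw [← Finset.smul_sum]
    have h1 : ∀ a : ZMod 6, extendZero L z + Finsupp.single c a + extendZero J v + k.left =
        (extendZero L z + extendZero J v + k.left) + Finsupp.single c a := fun a => by abel
    have h2 : ∀ (w : G →₀ ZMod 6) (a : ZMod 6),
        restrictTo I (w + Finsupp.single c a) = restrictTo I w := by
      intro w a
      ext x
      have : (x : G) ≠ c := fun h => hc (h ▸ x.2)
      simp [restrictTo_apply, this]
    simp only [h1, h2]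
    have h3 := map_sum (AddMonoidHom.single (fun _ : I → ZMod 6 => ZMod 2)
      (restrictTo I (extendZero L z + extendZero J v + k.left)))
      (fun a => ψ (extendZero L z + extendZero J v + k.left + Finsupp.single c a)) supportA
    rw [hψ, map_zero] at h3
    simp only [AddMonoidHom.single_apply] at h3
    rw [← h3, smul_zero]
  · rfl

/-- This is the reason why a block may be moved from `y n` to the anchor `c n` without changing its
class modulo `V`. -/
theorem detect_translate_lampSum_eq {L : Finset G} {c c' : G} (hc : c ∉ I) (hc' : c' ∉ I)
    (hψ : ∀ w a, ψ (w + Finsupp.single c a) = ψ (w + Finsupp.single c' a))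
    (W : (I → ZMod 6) → ZMod 2) (k : Wreath6 G) :
    detect I ψ (rightTranslation (ZMod 2) (Wreath6 G) (MulOpposite.op k) (lampSum L I c W)) =
      detect I ψ
        (rightTranslation (ZMod 2) (Wreath6 G) (MulOpposite.op k) (lampSum L I c' W)) := by
  rw [detect_translate_lampSum, detect_translate_lampSum]
  split_ifs
  · refine Finset.sum_congr rfl fun v _ => Finset.sum_congr rfl fun z _ =>
      Finset.sum_congr rfl fun a _ => ?_
    have h1 : ∀ c : G, extendZero L z + Finsupp.single c a + extendZero I v + k.left =
        (extendZero L z + extendZero I v + k.left) + Finsupp.single c a := fun c => by abel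
    have h2 : ∀ (w : G →₀ ZMod 6) (c : G), c ∉ I →
        restrictTo I (w + Finsupp.single c a) = restrictTo I w := by
      intro w c hc
      ext x
      have : (x : G) ≠ c := fun h => hc (h ▸ x.2)
      simp [restrictTo_apply, this]
    rw [h1, h1, hψ, h2 _ _ hc, h2 _ _ hc']
  · rfl

/-- For fixed `z` and `a` the weight does not depend on `v`, so the contribution is a multiple of a
translate of `W`, and `perp D` inherits translation invariance from `D`. -/
theorem detect_translate_lampSum_mem {L : Finset G} {c : G}
    (hψ : ∀ w v, ψ (w + extendZero I v) = ψ w)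
    {D : Submodule (ZMod 2) ((I → ZMod 6) → ZMod 2)} (hD : TranslationInvariant D)
    {W : (I → ZMod 6) → ZMod 2} (hW : W ∈ perp D) (k : Wreath6 G) :
    detect I ψ (rightTranslation (ZMod 2) (Wreath6 G) (MulOpposite.op k) (lampSum L I c W)) ∈
      perp D := by
  rw [detect_translate_lampSum]
  split_ifs
  · rw [Finset.sum_comm]
    refine Submodule.sum_mem _ fun z _ => ?_
    rw [Finset.sum_comm]
    refine Submodule.sum_mem _ fun a _ => ?_
    intro d hd
    set u := extendZero L z + Finsupp.single c a + k.left
    have h1 : ∀ v, extendZero L z + Finsupp.single c a + extendZero I v + k.left =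
        u + extendZero I v := fun v => by simp only [u]; abel
    have h2 : ∀ v, restrictTo I (extendZero I v) = v := fun v => by
      ext x
      simp [restrictTo_apply, extendZero_coe]
    simp only [h1, hψ, map_add, h2, Finset.sum_apply, Pi.smul_apply, smul_eq_mul, Finset.sum_mul]
    rw [Finset.sum_comm]
    have h3 := hW _ (hD (-restrictTo I u) d hd)
    rw [← mul_zero (ψ u), ← h3, Finset.mul_sum]
    refine Finset.sum_congr rfl fun v _ => ?_
    rw [Finset.sum_eq_single (restrictTo I u + v)]
    · rw [Pi.single_eq_same, sub_neg_eq_add, add_comm v]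
      ring
    · intro x _ hx
      rw [Pi.single_eq_of_ne hx, mul_zero, zero_mul]
    · simp
  · exact Submodule.zero_mem _

/-- Each configuration on `I` is counted with the total weight of a block, which is `1`. Hence the
test inverts `lampSum`, which identifies the kernel of the embedding. -/
theorem detect_lampSum_self {L : Finset G} {c : G} (hLI : Disjoint L I) (hc : c ∉ I)
    (hψ : ∀ w v, ψ (w + extendZero I v) = ψ w)
    (hsum : ∑ z : L → ZMod 6, ∑ a ∈ supportA, ψ (extendZero L z + Finsupp.single c a) = 1)
    (W : (I → ZMod 6) → ZMod 2) : detect I ψ (lampSum L I c W) = W := by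
  have h0 := detect_translate_lampSum (I := I) (ψ := ψ) L I c W 1
  rw [MulOpposite.op_one, map_one, Module.End.one_apply, if_pos RightSemidirect.one_right] at h0
  rw [h0]
  have h2 : ∀ (z : L → ZMod 6) (a : ZMod 6) (v : I → ZMod 6),
      restrictTo I (extendZero L z + Finsupp.single c a + extendZero I v) = v := by
    intro z a v
    ext x
    have h3 : (x : G) ≠ c := fun h => hc (h ▸ x.2)
    have h4 : (x : G) ∉ L := Finset.disjoint_right.1 hLI x.2
    simp [restrictTo_apply, extendZero_coe, extendZero_of_notMem, h3, h4]
  simp only [RightSemidirect.one_left, add_zero, h2, hψ, ← Finset.smul_sum]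
  have h5 : ∀ v : I → ZMod 6, ∑ z : L → ZMod 6, ∑ a ∈ supportA,
      (Pi.single v (ψ (extendZero L z + Finsupp.single c a)) : (I → ZMod 6) → ZMod 2) =
      Pi.single v 1 := by
    intro v
    rw [← hsum]
    simp only [← AddMonoidHom.single_apply, map_sum]
  simp only [h5]
  ext v
  simp [Finset.sum_apply, Pi.single_apply]

/-- The right-invariant subspace of the functions all of whose translates are sent into the
orthogonal complements of the spaces `D n` by the maps `detect (I n) (ψ n)`. -/
noncomputable def detectKernel (I : ℕ → Finset G) (ψ : ℕ → (G →₀ ZMod 6) → ZMod 2)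
    (D : ∀ n, Submodule (ZMod 2) ((I n → ZMod 6) → ZMod 2)) :
    Submodule (ZMod 2) (Wreath6 G →₀ ZMod 2) :=
  ⨅ (n : ℕ) (k : Wreath6 G), (perp (D n)).comap
    (detect (I n) (ψ n) ∘ₗ rightTranslation (ZMod 2) (Wreath6 G) (MulOpposite.op k))

theorem mem_detectKernel {I : ℕ → Finset G} {ψ : ℕ → (G →₀ ZMod 6) → ZMod 2}
    {D : ∀ n, Submodule (ZMod 2) ((I n → ZMod 6) → ZMod 2)} {P : Wreath6 G →₀ ZMod 2} :
    P ∈ detectKernel I ψ D ↔ ∀ n k, detect (I n) (ψ n)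
      (rightTranslation (ZMod 2) (Wreath6 G) (MulOpposite.op k) P) ∈ perp (D n) := by
  simp [detectKernel, Submodule.mem_iInf]

theorem detectKernel_rightInvariant (I : ℕ → Finset G) (ψ : ℕ → (G →₀ ZMod 6) → ZMod 2)
    (D : ∀ n, Submodule (ZMod 2) ((I n → ZMod 6) → ZMod 2)) :
    RightInvariant (detectKernel I ψ D) := by
  intro h P hP
  rw [Submodule.mem_comap, mem_detectKernel]
  intro n k
  have := mem_detectKernel.1 hP n (h.unop * k)
  rwa [← rightTranslation_mul] at this

theorem detect_mem_of_mem_detectKernel {I : ℕ → Finset G} {ψ : ℕ → (G →₀ ZMod 6) → ZMod 2}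
    {D : ∀ n, Submodule (ZMod 2) ((I n → ZMod 6) → ZMod 2)} {P : Wreath6 G →₀ ZMod 2}
    (hP : P ∈ detectKernel I ψ D) (n : ℕ) : detect (I n) (ψ n) P ∈ perp (D n) := by
  have := mem_detectKernel.1 hP n 1
  rwa [MulOpposite.op_one, map_one] at this

end Detect

/-! ### Upper bounds for word length in the inner wreath product -/

section WreathWords

variable {G : Type*} [Group G] {S : Finset G}

theorem wreathGenerators_inv (hS : ∀ s ∈ S, s⁻¹ ∈ S) :
    ∀ s ∈ wreathGenerators (S : Set G), s⁻¹ ∈ wreathGenerators (S : Set G) := by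
  have hlamp : ∀ w : G →₀ ZMod 6, (⟨w, 1⟩ : Wreath6 G)⁻¹ = ⟨-w, 1⟩ := by
    intro w
    refine RightSemidirect.ext ?_ ?_
    · rw [RightSemidirect.inv_left, inv_one, MulOpposite.op_one, map_one]; rfl
    · rw [RightSemidirect.inv_right, inv_one]
  rintro s ((rfl | rfl) | ⟨s, hs, rfl⟩)
  · exact Or.inl (Or.inr (hlamp _))
  · refine Or.inl (Or.inl ?_)
    rw [hlamp, neg_neg]
  · refine Or.inr ⟨s⁻¹, hS s hs, ?_⟩
    refine RightSemidirect.ext ?_ rfl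
    rw [RightSemidirect.inv_left, map_zero, neg_zero]

theorem hasWord_wreath_base {g : G} {n : ℕ} (hg : HasWord (S : Set G) g n) :
    HasWord (wreathGenerators (S : Set G)) (⟨0, g⟩ : Wreath6 G) n := by
  let f : G →* Wreath6 G :=
    { toFun := fun g => ⟨0, g⟩
      map_one' := rfl
      map_mul' := fun a b => RightSemidirect.ext
        (by rw [RightSemidirect.mul_left, map_zero, add_zero]) rfl }
  exact hg.map f fun s hs => Or.inr ⟨s, hs, rfl⟩

theorem hasWord_lamp_one (a : ZMod 6) :
    HasWord (wreathGenerators (S : Set G)) (lamp (Finsupp.single (1 : G) a))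
      a.valMinAbs.natAbs := by
  have hadd : ∀ (b : ZMod 6) (k : ℕ),
      lamp (Finsupp.single (1 : G) ((k : ZMod 6) * b)) = lamp (Finsupp.single (1 : G) b) ^ k := by
    intro b k
    induction k with
    | zero => simp [lamp_zero]
    | succ k ih => rw [pow_succ, ← ih, ← lamp_add, ← Finsupp.single_add]; push_cast; ring_nf
  have h1 : HasWord (wreathGenerators (S : Set G)) (lamp (Finsupp.single (1 : G) 1)) 1 :=
    HasWord.of_mem (Or.inl (Or.inl rfl))
  have h2 : HasWord (wreathGenerators (S : Set G)) (lamp (Finsupp.single (1 : G) (-1))) 1 := by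
    rw [Finsupp.single_neg]
    exact HasWord.of_mem (Or.inl (Or.inr rfl))
  have h3 : a = (a.valMinAbs.natAbs : ZMod 6) * 1 ∨ a = (a.valMinAbs.natAbs : ZMod 6) * (-1) := by
    revert a
    decide
  rcases h3 with h | h
  · have := h1.pow a.valMinAbs.natAbs
    rwa [← hadd, ← h, mul_one] at this
  · have := h2.pow a.valMinAbs.natAbs
    rwa [← hadd, ← h, mul_one] at this

theorem hasWord_lamp_single (hS : ∀ s ∈ S, s⁻¹ ∈ S) {x : G} {n : ℕ}
    (hx : HasWord (S : Set G) x n) (a : ZMod 6) :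
    HasWord (wreathGenerators (S : Set G)) (lamp (Finsupp.single x a))
      (2 * n + a.valMinAbs.natAbs) := by
  have h := (hasWord_wreath_base (hx.inv hS)).mul ((hasWord_lamp_one a).mul (hasWord_wreath_base hx))
  have heq : (⟨0, x⁻¹⟩ : Wreath6 G) * (lamp (Finsupp.single (1 : G) a) * ⟨0, x⟩) =
      lamp (Finsupp.single x a) := by
    refine RightSemidirect.ext ?_ ?_
    · simp [RightSemidirect.mul_left, lamp, rightTranslation_single]
    · simp [RightSemidirect.mul_right, lamp]
  rw [heq] at h
  exact h.mono (by omega)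

variable [DecidableEq G]

/-- Every lit lamp is paid for by a separate round trip of length at most `2 * b`. A nonzero value
has length at least `1`, so the trip is absorbed into the factor `2 * b + 1`. -/
theorem hasWord_lamp_extendZero (hS : ∀ s ∈ S, s⁻¹ ∈ S) {T : Finset G} {b : ℕ}
    (hT : ∀ x ∈ T, HasWord (S : Set G) x b) (v : T → ZMod 6) :
    HasWord (wreathGenerators (S : Set G)) (lamp (extendZero T v))
      ((2 * b + 1) * ∑ x, (v x).valMinAbs.natAbs) := by
  rw [extendZero_eq_sum, Finset.mul_sum]
  induction (Finset.univ : Finset T) using Finset.induction_on with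
  | empty => simpa [lamp_zero] using HasWord.one
  | insert x s hx ih =>
    rw [Finset.sum_insert hx, Finset.sum_insert hx, lamp_add]
    refine HasWord.mul ?_ ih
    by_cases h0 : v x = 0
    · rw [h0, Finsupp.single_zero, lamp_zero]
      exact HasWord.one
    · refine (hasWord_lamp_single hS (hT x x.2) (v x)).mono ?_
      have h1 : 1 ≤ (v x).valMinAbs.natAbs := by
        rw [Nat.one_le_iff_ne_zero, ne_eq, Int.natAbs_eq_zero, ZMod.valMinAbs_eq_zero]
        exact h0
      nlinarith

end WreathWords

/-! ### Words in the outer semidirect product -/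

section QuotientWords

variable {H : Type*} [Group H] {V : Submodule (ZMod 2) (H →₀ ZMod 2)} {hV : RightInvariant V}
  {S : Set H}

theorem quotient_inv_mul (a b : (H →₀ ZMod 2) ⧸ V) :
    (⟨a, 1⟩ : QuotientWreath V hV)⁻¹ * ⟨b, 1⟩ = ⟨b - a, 1⟩ := by
  refine RightSemidirect.ext ?_ ?_
  · rw [RightSemidirect.mul_left, RightSemidirect.inv_left, inv_one, MulOpposite.op_one, map_one,
      Module.End.one_apply, Module.End.one_apply]
    exact neg_add_eq_sub a b
  · rw [RightSemidirect.mul_right, RightSemidirect.inv_right, inv_one, mul_one]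

theorem hasWord_quotient_base {h : H} {n : ℕ} (hh : HasWord S h n) :
    HasWord (quotientWreathGenerators V hV S) (⟨0, h⟩ : QuotientWreath V hV) n := by
  let f : H →* QuotientWreath V hV :=
    { toFun := fun g => ⟨0, g⟩
      map_one' := rfl
      map_mul' := fun a b => RightSemidirect.ext
        (by rw [RightSemidirect.mul_left, map_zero, add_zero]) rfl }
  exact hh.map f fun s hs => Or.inr ⟨s, hs, rfl⟩

/-- Prepending a word for `(P, 1)` to a word for `(f, h)`. -/
theorem hasWord_quotient_add {P : H →₀ ZMod 2} {f : (H →₀ ZMod 2) ⧸ V} {h : H} {m n : ℕ}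
    (hP : HasWord (quotientWreathGenerators V hV S)
      (⟨Submodule.Quotient.mk P, 1⟩ : QuotientWreath V hV) m)
    (hf : HasWord (quotientWreathGenerators V hV S) (⟨f, h⟩ : QuotientWreath V hV) n) :
    HasWord (quotientWreathGenerators V hV S)
      (⟨Submodule.Quotient.mk (rightTranslation (ZMod 2) H (MulOpposite.op h) P) + f, h⟩ :
        QuotientWreath V hV) (m + n) := by
  have := hP.mul hf
  convert this using 1
  exact RightSemidirect.ext rfl (one_mul h).symm

/-- Prepending a word for the base element `k` to a word for `(f, h)`. -/
theorem hasWord_quotient_move {f : (H →₀ ZMod 2) ⧸ V} {h k : H} {m n : ℕ} (hk : HasWord S k m)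
    (hf : HasWord (quotientWreathGenerators V hV S) (⟨f, h⟩ : QuotientWreath V hV) n) :
    HasWord (quotientWreathGenerators V hV S) (⟨f, k * h⟩ : QuotientWreath V hV) (m + n) := by
  have := (hasWord_quotient_base (V := V) (hV := hV) hk).mul hf
  convert this using 1
  refine RightSemidirect.ext ?_ rfl
  rw [RightSemidirect.mul_left, map_zero, zero_add]

theorem hasWord_quotient_translate (hS : ∀ s ∈ S, s⁻¹ ∈ S) {P : H →₀ ZMod 2} {h : H} {m n : ℕ}
    (hP : HasWord (quotientWreathGenerators V hV S)
      (⟨Submodule.Quotient.mk P, 1⟩ : QuotientWreath V hV) m) (hh : HasWord S h n) :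
    HasWord (quotientWreathGenerators V hV S)
      (⟨Submodule.Quotient.mk (rightTranslation (ZMod 2) H (MulOpposite.op h) P), 1⟩ :
        QuotientWreath V hV) (2 * n + m) := by
  have h1 := hasWord_quotient_add hP (hasWord_quotient_base (V := V) (hV := hV) hh)
  have h2 := hasWord_quotient_move (hh.inv hS) h1
  rw [inv_mul_cancel, add_zero] at h2
  exact h2.mono (by omega)

theorem hasWord_quotient_sum {ι : Type*} (s : Finset ι) (P : ι → H →₀ ZMod 2) (m : ι → ℕ)
    (hP : ∀ i ∈ s, HasWord (quotientWreathGenerators V hV S)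
      (⟨Submodule.Quotient.mk (P i), 1⟩ : QuotientWreath V hV) (m i)) :
    HasWord (quotientWreathGenerators V hV S)
      (⟨Submodule.Quotient.mk (∑ i ∈ s, P i), 1⟩ : QuotientWreath V hV) (∑ i ∈ s, m i) := by
  classical
  induction s using Finset.induction_on with
  | empty => exact HasWord.one
  | insert i s hi ih =>
    rw [Finset.sum_insert hi, Finset.sum_insert hi]
    have h1 := hasWord_quotient_add (hP i (Finset.mem_insert_self i s))
      (ih fun j hj => hP j (Finset.mem_insert_of_mem hj))
    rw [MulOpposite.op_one, map_one, Module.End.one_apply, ← Submodule.Quotient.mk_add] at h1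
    exact h1

theorem hasWord_quotient_single (hS : ∀ s ∈ S, s⁻¹ ∈ S) {h : H} {n : ℕ} (hh : HasWord S h n) :
    HasWord (quotientWreathGenerators V hV S)
      (⟨Submodule.Quotient.mk (Finsupp.single h 1), 1⟩ : QuotientWreath V hV) (2 * n + 1) := by
  have h1 : HasWord (quotientWreathGenerators V hV S)
      (⟨Submodule.Quotient.mk (Finsupp.single 1 1), 1⟩ : QuotientWreath V hV) 1 :=
    HasWord.of_mem (Or.inl rfl)
  have h2 := hasWord_quotient_translate hS h1 hh
  rwa [rightTranslation_single, one_mul] at h2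

/-- A word that follows a path through the points `q x` and adds translates of `P` on its way. -/
theorem hasWord_quotient_path {X : Type*} [Fintype X] [DecidableEq X] {d : X → X → ℕ} {q : X → H}
    {P : H →₀ ZMod 2} {cP cM : ℕ}
    (hP : HasWord (quotientWreathGenerators V hV S)
      (⟨Submodule.Quotient.mk P, 1⟩ : QuotientWreath V hV) cP)
    (hM : ∀ x x', HasWord S (q x * (q x')⁻¹) (cM * d x x')) (hd : ∀ x x', x ≠ x' → 1 ≤ d x x')
    {x₀ : X} (hq : q x₀ = 1) (l : List X) (x : X) (W : X → ZMod 2)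
    (hW : ∀ v, W v ≠ 0 → v ∈ x :: (l ++ [x₀])) :
    HasWord (quotientWreathGenerators V hV S)
      (⟨Submodule.Quotient.mk (∑ v, W v • rightTranslation (ZMod 2) H (MulOpposite.op (q v)) P),
        q x⟩ : QuotientWreath V hV) (cP + (cP + cM) * pathLength d (x :: (l ++ [x₀]))) := by
  -- One edge of the path, with the word built from its end. Removing `x` from `W` prevents a point
  -- visited twice from being added twice. An edge with `x ≠ x'` has length at least `1`, so it can
  -- also pay `cP` for the translate at `x`.
  have hstep : ∀ (x x' : X) (l : List X),
      (∀ W : X → ZMod 2, (∀ v, W v ≠ 0 → v ∈ x' :: l) → HasWord (quotientWreathGenerators V hV S)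
        (⟨Submodule.Quotient.mk (∑ v, W v • rightTranslation (ZMod 2) H (MulOpposite.op (q v)) P),
          q x'⟩ : QuotientWreath V hV) (cP + (cP + cM) * pathLength d (x' :: l))) →
      ∀ W : X → ZMod 2, (∀ v, W v ≠ 0 → v ∈ x :: x' :: l) →
        HasWord (quotientWreathGenerators V hV S)
        (⟨Submodule.Quotient.mk (∑ v, W v • rightTranslation (ZMod 2) H (MulOpposite.op (q v)) P),
          q x⟩ : QuotientWreath V hV) (cP + (cP + cM) * pathLength d (x :: x' :: l)) := by
    intro x x' l ih W hW
    have hlen : pathLength d (x :: x' :: l) = d x x' + pathLength d (x' :: l) := rfl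
    rw [hlen]
    by_cases hx : x = x'
    · subst hx
      refine (ih W fun v hv => ?_).mono (by gcongr; omega)
      rcases List.mem_cons.1 (hW v hv) with h | h
      · exact h ▸ List.mem_cons_self
      · exact h
    · have h1 := hd x x' hx
      have h2 := ih (Function.update W x 0) fun v hv => by
        by_cases hvx : v = x
        · exact absurd (by rw [hvx, Function.update_self]) hv
        · rw [Function.update_of_ne hvx] at hv
          exact (List.mem_cons.1 (hW v hv)).resolve_left hvx
      have h3 := hasWord_quotient_move (hM x x') h2
      rw [inv_mul_cancel_right] at h3
      have hsum : (∑ v, W v • rightTranslation (ZMod 2) H (MulOpposite.op (q v)) P) =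
          W x • rightTranslation (ZMod 2) H (MulOpposite.op (q x)) P +
          ∑ v, Function.update W x 0 v • rightTranslation (ZMod 2) H (MulOpposite.op (q v)) P := by
        rw [← Finset.add_sum_erase _ _ (Finset.mem_univ x),
          ← Finset.add_sum_erase (a := x) _ (fun v => Function.update W x 0 v •
            rightTranslation (ZMod 2) H (MulOpposite.op (q v)) P) (Finset.mem_univ x)]
        rw [Function.update_self, zero_smul, zero_add]
        congr 1
        refine Finset.sum_congr rfl fun v hv => ?_
        rw [Function.update_of_ne (Finset.ne_of_mem_erase hv)]
      have hle : cM * d x x' + (cP + (cP + cM) * pathLength d (x' :: l)) + cP ≤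
          cP + (cP + cM) * (d x x' + pathLength d (x' :: l)) := by nlinarith
      rcases (by decide : ∀ a : ZMod 2, a = 0 ∨ a = 1) (W x) with h0 | h0
      · rw [hsum, h0, zero_smul, zero_add]
        exact h3.mono (by omega)
      · rw [hsum, h0, one_smul, Submodule.Quotient.mk_add]
        exact (hasWord_quotient_add hP h3).mono (by omega)
  induction l generalizing x W with
  | nil =>
    refine hstep x x₀ [] (fun W hW => ?_) W hW
    have hsum : (∑ v, W v • rightTranslation (ZMod 2) H (MulOpposite.op (q v)) P) = W x₀ • P := by
      rw [Finset.sum_eq_single x₀, hq, MulOpposite.op_one, map_one, Module.End.one_apply]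
      · intro v _ hv
        have : W v = 0 := by
          by_contra h
          exact hv (by simpa using hW v h)
        rw [this, zero_smul]
      · simp
    rw [hsum, hq]
    rcases (by decide : ∀ a : ZMod 2, a = 0 ∨ a = 1) (W x₀) with h0 | h0
    · rw [h0, zero_smul]
      exact HasWord.one
    · rw [h0, one_smul]
      exact hP.mono (by omega)
  | cons x' l ih => exact hstep x x' (l ++ [x₀]) (fun W hW => ih x' W hW) W hW

end QuotientWords

/-! ### Upper bound for word length by tours -/

section UpperBound

variable {G : Type*} [Group G] [DecidableEq G] {S : Finset G}

/-- An upper bound for the length of the sum of the point masses at the lamp configurations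
supported on `E`, in every quotient of `ℤ₂ ≀ (ℤ₆ ≀ G)`. -/
noncomputable def configurationCost (S : Finset G) (E : Finset G) : ℕ :=
  ∑ z : E → ZMod 6,
    (2 * wordLength (wreathGenerators (S : Set G)) (lamp (extendZero E z)) + 1)

variable {V : Submodule (ZMod 2) (Wreath6 G →₀ ZMod 2)} {hV : RightInvariant V}

/-- The block is the sum of four translates, one for each value of the lamp at `c`, of a single sum
over the configurations on `L`. Each translate costs at most `2 * (2 * n + 3)` in addition to that
sum. -/
theorem hasWord_block (hS : ∀ s ∈ S, s⁻¹ ∈ S) (hgen : Subgroup.closure (S : Set G) = ⊤)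
    (L : Finset G) {c : G} {n : ℕ} (hc : HasWord (S : Set G) c n) :
    HasWord (quotientWreathGenerators V hV (wreathGenerators (S : Set G)))
      (⟨Submodule.Quotient.mk (block L c), 1⟩ : QuotientWreath V hV)
      (16 * n + 24 + 4 * configurationCost S L) := by
  have h1 : HasWord (quotientWreathGenerators V hV (wreathGenerators (S : Set G)))
      (⟨Submodule.Quotient.mk (∑ z : L → ZMod 6, Finsupp.single (lamp (extendZero L z)) 1), 1⟩ :
        QuotientWreath V hV) (configurationCost S L) := by
    refine hasWord_quotient_sum _ _ _ fun z _ => ?_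
    refine hasWord_quotient_single (wreathGenerators_inv hS) ?_
    refine HasWord.shortest (hasWord_lamp_extendZero (b := L.sup (wordLength (S : Set G))) hS
      (fun x hx => ?_) z)
    exact (hasWord_wordLength hS hgen x).mono (Finset.le_sup hx)
  have h2 : block L c = ∑ a ∈ supportA, rightTranslation (ZMod 2) (Wreath6 G)
      (MulOpposite.op (lamp (Finsupp.single c a)))
      (∑ z : L → ZMod 6, Finsupp.single (lamp (extendZero L z)) 1) := by
    rw [block, Finset.sum_comm]
    simp only [map_sum, rightTranslation_single, ← lamp_add]
  rw [h2]
  have h3 := hasWord_quotient_sum (V := V) (hV := hV) supportA _ _ fun a _ =>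
    hasWord_quotient_translate (wreathGenerators_inv hS) h1 (hasWord_lamp_single hS hc a)
  refine h3.mono ?_
  have h4 : ∀ a ∈ supportA, 2 * (2 * n + a.valMinAbs.natAbs) + configurationCost S L ≤
      4 * n + 6 + configurationCost S L := by
    intro a _
    have : a.valMinAbs.natAbs ≤ 3 := by revert a; decide
    omega
  refine (Finset.sum_le_card_nsmul _ _ _ h4).trans ?_
  have : supportA.card = 4 := by decide
  rw [this, smul_eq_mul]
  omega

theorem one_le_hammingSix {T : Type*} [Fintype T] {v w : T → ZMod 6} (h : v ≠ w) :
    1 ≤ hammingSix v w := by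
  rw [Nat.one_le_iff_ne_zero]
  intro h0
  refine h (funext fun x => ?_)
  have := (Finset.sum_eq_zero_iff.1 h0) x (Finset.mem_univ x)
  rw [Int.natAbs_eq_zero, ZMod.valMinAbs_eq_zero] at this
  exact sub_eq_zero.1 this

theorem hasWord_lampSum (hS : ∀ s ∈ S, s⁻¹ ∈ S) (hgen : Subgroup.closure (S : Set G) = ⊤)
    {L I : Finset G} {c : G} {n b : ℕ} (hc : HasWord (S : Set G) c n)
    (hI : ∀ x ∈ I, HasWord (S : Set G) x b) {W : (I → ZMod 6) → ZMod 2}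
    {l : List (I → ZMod 6)} (hW : ∀ v, W v ≠ 0 → v ∈ 0 :: l) :
    HasWord (quotientWreathGenerators V hV (wreathGenerators (S : Set G)))
      (⟨Submodule.Quotient.mk (lampSum L I c W), 1⟩ : QuotientWreath V hV)
      ((16 * n + 24 + 4 * configurationCost S L) +
        ((16 * n + 24 + 4 * configurationCost S L) + (2 * b + 1)) *
          pathLength hammingSix (0 :: (l ++ [0]))) := by
  have hq : (fun v : I → ZMod 6 => lamp (extendZero I v)) 0 = 1 := by
    simp [lamp_zero]
  have h := hasWord_quotient_path (q := fun v : I → ZMod 6 => lamp (extendZero I v))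
    (d := hammingSix) (cM := 2 * b + 1) (hasWord_block (V := V) (hV := hV) hS hgen L hc) ?_
    (fun _ _ => one_le_hammingSix) hq l 0 W ?_
  · rw [map_zero (extendZero I), lamp_zero] at h
    rwa [lampSum_apply]
  · intro v v'
    have : lamp (extendZero I v) * (lamp (extendZero I v'))⁻¹ = lamp (extendZero I (v - v')) := by
      rw [mul_inv_eq_iff_eq_mul, ← lamp_add, ← map_add, sub_add_cancel]
    rw [this]
    exact hasWord_lamp_extendZero hS hI (v - v')
  · intro v hv
    have := hW v hv
    simp only [List.mem_cons, List.mem_append] at this ⊢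
    tauto

end UpperBound

/-! ### From words to tours -/

section LowerBound

theorem hammingSix_add_single {T : Type*} [Fintype T] [DecidableEq T] (v : T → ZMod 6) (x : T)
    (a b : ZMod 6) :
    hammingSix (v + Pi.single x a) (v + Pi.single x b) = (a - b).valMinAbs.natAbs := by
  rw [hammingSix, Finset.sum_eq_single x]
  · simp
  · intro y _ hy
    simp [hy]
  · simp

variable {G : Type*} [DecidableEq G] {I : Finset G}

theorem hammingSix_le_three {z : G} {v w : I → ZMod 6}
    (h : ∀ x : I, (x : G) ≠ z → v x = w x) : hammingSix v w ≤ 3 := by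
  by_cases hz : z ∈ I
  · rw [hammingSix, Finset.sum_eq_single ⟨z, hz⟩]
    · exact (by decide : ∀ a : ZMod 6, a.valMinAbs.natAbs ≤ 3) _
    · intro y _ hy
      rw [h y fun h' => hy (Subtype.ext h')]
      simp
    · simp
  · have : v = w := funext fun x => h x fun h' => hz (h' ▸ x.2)
    subst this
    simp [hammingSix]

/-- Prefixing to a path a point and a loop through all points that differ from it at `x`. -/
theorem exists_loop (x : I) {z : G} {v v₀ : I → ZMod 6} (h : ∀ x : I, (x : G) ≠ z → v x = v₀ x)
    (p : List (I → ZMod 6)) :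
    ∃ p' : List (I → ZMod 6), (∀ w ∈ v₀ :: (p ++ [0]), w ∈ v :: (p' ++ [0])) ∧
      (∀ w : I → ZMod 6, (∀ x' : I, (x' : G) ≠ x → w x' = v x') → w ∈ v :: (p' ++ [0])) ∧
      pathLength hammingSix (v :: (p' ++ [0])) ≤ pathLength hammingSix (v₀ :: (p ++ [0])) + 9 := by
  let e : ZMod 6 → I → ZMod 6 := fun a => v + Pi.single x a
  have he0 : e 0 = v := by simp [e]
  -- Six unit steps run through all values at `x` and return to `v`. The step from `v` to `v₀`
  -- changes one coordinate and costs at most `3`, whence the constant `9`.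
  refine ⟨e 5 :: e 4 :: e 3 :: e 2 :: e 1 :: e 0 :: v₀ :: p, ?_, ?_, ?_⟩
  · intro w hw
    simp only [List.mem_cons, List.cons_append] at hw ⊢
    tauto
  · intro w hw
    have hwe : w = e (w x - v x) := by
      ext x'
      by_cases hx : x' = x
      · subst hx; simp [e]
      · simp [e, hx, hw x' fun h => hx (Subtype.ext h)]
    have hcases : ∀ a : ZMod 6, a = 0 ∨ a = 1 ∨ a = 2 ∨ a = 3 ∨ a = 4 ∨ a = 5 := by decide
    rw [hwe]
    rcases hcases (w x - v x) with h | h | h | h | h | h <;> rw [h] <;> simp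
  · have hd : ∀ a b, hammingSix (e a) (e b) = (a - b).valMinAbs.natAbs :=
      fun a b => hammingSix_add_single v x a b
    have h3 := hammingSix_le_three h
    nth_rewrite 1 [← he0]
    simp only [List.cons_append, pathLength, hd]
    rw [he0]
    have h1 : ((0 : ZMod 6) - 5).valMinAbs.natAbs = 1 := by decide
    have h2 : ((5 : ZMod 6) - 4).valMinAbs.natAbs = 1 := by decide
    have h4 : ((4 : ZMod 6) - 3).valMinAbs.natAbs = 1 := by decide
    have h5 : ((3 : ZMod 6) - 2).valMinAbs.natAbs = 1 := by decide
    have h6 : ((2 : ZMod 6) - 1).valMinAbs.natAbs = 1 := by decide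
    have h7 : ((1 : ZMod 6) - 0).valMinAbs.natAbs = 1 := by decide
    rw [h1, h2, h4, h5, h6, h7]
    omega

variable [Group G] {S : Finset G} {V : Submodule (ZMod 2) (Wreath6 G →₀ ZMod 2)}
  {hV : RightInvariant V}

/-- Induction over the suffixes of the word. Here `z` is the last member of `I` at which a tour
stretch was started, or `1`. The tour already contains every configuration that differs from `v₀` at
most at `z`, so further changes of the lamp at `z` are free. The last inequality is a potential
argument: each move away from `z` saves `9` towards the next stretch, which costs at most `9 * r`.
-/
theorem exists_walk_of_word (hS : ∀ s ∈ S, s⁻¹ ∈ S)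
    (hgen : Subgroup.closure (S : Set G) = ⊤) {r : ℝ} (hr : 0 < r)
    (hlen : ∀ x ∈ I, r ≤ (wordLength (S : Set G) x : ℝ))
    (hdist : ∀ x ∈ I, ∀ x' ∈ I, x ≠ x' → r ≤ (rightWordDist (S : Set G) x x' : ℝ))
    (l : List (QuotientWreath V hV))
    (hl : ∀ s ∈ l, s ∈ quotientWreathGenerators V hV (wreathGenerators (S : Set G))) :
    ∃ (P : Wreath6 G →₀ ZMod 2) (z : G) (v₀ : I → ZMod 6) (p : List (I → ZMod 6)),
      Submodule.Quotient.mk P = l.prod.left ∧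
      (∀ x, l.prod.right.left x ≠ 0 → wordLength (S : Set G) x ≤ l.length) ∧
      wordLength (S : Set G) l.prod.right.right ≤ l.length ∧
      (∀ h, P h ≠ 0 → ∀ x, h.left x ≠ 0 → wordLength (S : Set G) x ≤ l.length) ∧
      (∀ h, P h ≠ 0 → restrictTo I h.left ∈ v₀ :: (p ++ [0])) ∧
      (∀ v : I → ZMod 6, (∀ x : I, (x : G) ≠ z → v x = v₀ x) → v ∈ v₀ :: (p ++ [0])) ∧
      (∀ x : I, (x : G) ≠ z → l.prod.right.left x = v₀ x) ∧
      (z = 1 ∨ z ∈ I) ∧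
      r * pathLength hammingSix (v₀ :: (p ++ [0])) +
        9 * rightWordDist (S : Set G) z l.prod.right.right ≤ 9 * l.length := by
  induction l with
  | nil =>
    -- The members of `I` have positive length, so `1 ∉ I` and agreement off `z = 1` leaves only the
    -- zero configuration.
    refine ⟨0, 1, 0, [], rfl, ?_, ?_, by simp, by simp, ?_, ?_, Or.inl rfl, ?_⟩
    · intro x hx
      exact absurd rfl hx
    · exact (wordLength_one _).le
    · intro v hv
      have : v = 0 := by
        ext x
        refine hv x fun h => ?_
        have := hlen x x.2
        rw [h, wordLength_one] at this
        simp only [Nat.cast_zero] at this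
        linarith
      simp [this]
    · intro x _
      rfl
    · have h1 : rightWordDist (S : Set G) 1 (1 : G) = 0 := by
        rw [rightWordDist, inv_one, mul_one, wordLength_one]
      have h2 : ([] : List (QuotientWreath V hV)).prod.right.right = 1 := rfl
      rw [h2, h1]
      simp [pathLength, hammingSix]
  | cons s l ih =>
    obtain ⟨P, z, v₀, p, h1, h2, h3, h4, h5, h6, h7, h8, h9⟩ :=
      ih fun s hs => hl s (List.mem_cons_of_mem _ hs)
    rw [List.prod_cons, List.length_cons]
    generalize l.prod = k at *
    have h4' : ∀ h, P h ≠ 0 → ∀ x, h.left x ≠ 0 → wordLength (S : Set G) x ≤ l.length + 1 :=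
      fun h hh x hx => (h4 h hh x hx).trans (Nat.le_succ _)
    rcases hl s List.mem_cons_self with hs | ⟨t, ht, hs⟩
    · -- a lamp of the outer group is switched
      have hs : s = ⟨Submodule.Quotient.mk (Finsupp.single 1 1), 1⟩ := hs
      have hright : (s * k).right = k.right := by rw [RightSemidirect.mul_right, hs, one_mul]
      rw [hright]
      have hsupp : ∀ h, (Finsupp.single k.right (1 : ZMod 2) + P) h ≠ 0 → h = k.right ∨ P h ≠ 0 := by
        intro h hh
        by_contra! hne
        rw [Finsupp.add_apply, Finsupp.single_eq_of_ne hne.1, hne.2, add_zero] at hh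
        exact hh rfl
      refine ⟨Finsupp.single k.right 1 + P, z, v₀, p, ?_, fun x hx => (h2 x hx).trans (Nat.le_succ _),
        h3.trans (Nat.le_succ _), ?_, ?_, h6, h7, h8, ?_⟩
      · rw [RightSemidirect.mul_left, hs, Submodule.Quotient.mk_add, h1]
        congr 1
        rw [← one_mul k.right, ← rightTranslation_single, one_mul]
        rfl
      · intro h hh x hx
        rcases hsupp h hh with rfl | hh
        · exact (h2 x hx).trans (Nat.le_succ _)
        · exact h4' h hh x hx
      · intro h hh
        rcases hsupp h hh with rfl | hh
        · exact h6 _ h7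
        · exact h5 h hh
      · push_cast
        linarith
    · subst hs
      have hleft : ((⟨0, t⟩ : QuotientWreath V hV) * k).left = k.left := by
        rw [RightSemidirect.mul_left, map_zero, zero_add]
      have hright : ((⟨0, t⟩ : QuotientWreath V hV) * k).right = t * k.right := rfl
      rw [hleft, hright]
      rcases ht with ht | ⟨g, hg, rfl⟩
      · -- the lamp of the inner group at the current position is changed
        obtain ⟨a, rfl⟩ : ∃ a : ZMod 6, t = lamp (Finsupp.single 1 a) := by
          rcases ht with ht | ht
          · exact ⟨1, ht⟩
          · refine ⟨-1, ?_⟩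
            rw [Finsupp.single_neg]
            exact ht
        have hl1 : (lamp (Finsupp.single 1 a) * k.right).left =
            Finsupp.single k.right.right a + k.right.left := by
          rw [RightSemidirect.mul_left]
          congr 1
          exact (rightTranslation_single _ _ _).trans (by rw [one_mul])
        have hr1 : (lamp (Finsupp.single 1 a) * k.right).right = k.right.right := by
          rw [RightSemidirect.mul_right]; exact one_mul _
        rw [hl1, hr1]
        have h2' : ∀ x, (Finsupp.single k.right.right a + k.right.left) x ≠ 0 →
            wordLength (S : Set G) x ≤ l.length + 1 := by
          intro x hx
          by_cases hxg : x = k.right.right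
          · exact hxg ▸ h3.trans (Nat.le_succ _)
          · rw [Finsupp.add_apply, Finsupp.single_eq_of_ne hxg, zero_add] at hx
            exact (h2 x hx).trans (Nat.le_succ _)
        -- A new stretch is needed only for a lamp in `I` other than the one at `z`. The position is
        -- then at distance at least `r` from `z`, and resetting `z` releases the saved `9 * r`.
        by_cases hgz : k.right.right ∈ I ∧ k.right.right ≠ z
        · obtain ⟨hgI, hgz⟩ := hgz
          obtain ⟨p', hp1, hp2, hp3⟩ := exists_loop ⟨k.right.right, hgI⟩
            (v := restrictTo I k.right.left) h7 p
          refine ⟨P, k.right.right, restrictTo I k.right.left, p', h1, h2',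
            h3.trans (Nat.le_succ _), h4', fun h hh => hp1 _ (h5 h hh), hp2, ?_, Or.inr hgI, ?_⟩
          · intro x hx
            rw [Finsupp.add_apply, Finsupp.single_eq_of_ne hx, zero_add]
            rfl
          · have hd0 : rightWordDist (S : Set G) k.right.right k.right.right = 0 := by
              rw [rightWordDist, mul_inv_cancel, wordLength_one]
            have hrz : r ≤ rightWordDist (S : Set G) z k.right.right := by
              rcases h8 with rfl | hz
              · have hw := (((hasWord_wordLength hS hgen (k.right.right)⁻¹).inv hS).wordLength_le)
                rw [inv_inv] at hw
                rw [rightWordDist, one_mul]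
                exact (hlen _ hgI).trans (by exact_mod_cast hw)
              · exact hdist _ hz _ hgI hgz.symm
            have hp3' : (pathLength hammingSix (restrictTo I k.right.left :: (p' ++ [0])) : ℝ) ≤
                pathLength hammingSix (v₀ :: (p ++ [0])) + 9 := by exact_mod_cast hp3
            have := mul_le_mul_of_nonneg_left hp3' hr.le
            rw [hd0]
            push_cast
            linarith
        · refine ⟨P, z, v₀, p, h1, h2', h3.trans (Nat.le_succ _), h4', h5, h6, ?_, h8, ?_⟩
          · intro x hx
            have hxg : (x : G) ≠ k.right.right := fun h => hgz ⟨h ▸ x.2, h ▸ hx⟩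
            rw [Finsupp.add_apply, Finsupp.single_eq_of_ne hxg, zero_add]
            exact h7 x hx
          · push_cast
            linarith
      · -- the position in the inner group moves
        have hl1 : ((⟨0, g⟩ : Wreath6 G) * k.right).left = k.right.left := by
          rw [RightSemidirect.mul_left, map_zero, zero_add]
        have hr1 : ((⟨0, g⟩ : Wreath6 G) * k.right).right = g * k.right.right := rfl
        rw [hl1, hr1]
        have hg1 : HasWord (S : Set G) g 1 := HasWord.of_mem hg
        refine ⟨P, z, v₀, p, h1, fun x hx => (h2 x hx).trans (Nat.le_succ _), ?_, h4', h5, h6, h7,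
          h8, ?_⟩
        · exact (wordLength_mul_le hS hgen _ _).trans
            (by have := hg1.wordLength_le; omega)
        · have hd : rightWordDist (S : Set G) z (g * k.right.right) ≤
              rightWordDist (S : Set G) z k.right.right + 1 := by
            rw [rightWordDist, rightWordDist, mul_inv_rev, ← mul_assoc]
            exact (wordLength_mul_le hS hgen _ _).trans
              (Nat.add_le_add_left (hg1.inv hS).wordLength_le _)
          have hd' : (rightWordDist (S : Set G) z (g * k.right.right) : ℝ) ≤
              rightWordDist (S : Set G) z k.right.right + 1 := by exact_mod_cast hd
          push_cast
          linarith

end LowerBound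

/-! ### Distortion and the traveling salesman quotient metric -/

section Metric

theorem distortion_le {X Z : Type*} {ρ : X → X → ℕ} {θ : Z → Z → ℕ} {f : X → Z} {α β : ℝ}
    (hα : 0 ≤ α) (hβ : 0 ≤ β) (hf : Function.Injective f)
    (h1 : ∀ u v, u ≠ v → (θ (f u) (f v) : ℝ) ≤ α * ρ u v)
    (h2 : ∀ u v, u ≠ v → (ρ u v : ℝ) ≤ β * θ (f u) (f v)) :
    distortion ρ θ f ≤ ENNReal.ofReal (α * β) := by
  rw [distortion, if_pos hf, ENNReal.ofReal_mul hα]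
  refine mul_le_mul' (iSup_le fun u => iSup_le fun v => iSup_le fun huv => ?_)
    (iSup_le fun u => iSup_le fun v => iSup_le fun huv => ?_)
  · refine ENNReal.div_le_of_le_mul ?_
    rw [← ENNReal.ofReal_natCast, ← ENNReal.ofReal_natCast, ← ENNReal.ofReal_mul hα]
    exact ENNReal.ofReal_le_ofReal (h1 u v huv)
  · refine ENNReal.div_le_of_le_mul ?_
    rw [← ENNReal.ofReal_natCast, ← ENNReal.ofReal_natCast, ← ENNReal.ofReal_mul hβ]
    exact ENNReal.ofReal_le_ofReal (h2 u v huv)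

theorem expansionRatio_le {X Z : Type*} {ρ : X → X → ℕ} {θ : Z → Z → ℕ} {f : X → Z} {α : ℝ}
    (hα : 0 ≤ α) {u v : X} (huv : u ≠ v) (h : (θ (f u) (f v) : ℝ) ≤ α * ρ u v) :
    expansionRatio ρ θ f ≤ ENNReal.ofReal α := by
  refine (iInf_le_of_le u <| iInf_le_of_le v <| iInf_le_of_le huv le_rfl).trans ?_
  refine ENNReal.div_le_of_le_mul ?_
  rw [← ENNReal.ofReal_natCast, ← ENNReal.ofReal_natCast, ← ENNReal.ofReal_mul hα]
  exact ENNReal.ofReal_le_ofReal h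

variable {X : Type*} {d : X → X → ℕ} {x₀ : X}

theorem TS_le {A B : X → ZMod 2} {l : List X} (hl : ∀ x, A x + B x ≠ 0 → x ∈ x₀ :: l) :
    TS d x₀ A B ≤ pathLength d (x₀ :: (l ++ [x₀])) + 1 := by
  rw [TS]
  split_ifs
  · exact Nat.zero_le _
  · refine Nat.add_le_add_right (Nat.sInf_le ?_) 1
    exact ⟨l, hl, rfl⟩

/-- Finiteness of `X` provides a cycle through all points, so the infimum is attained and is not the
default value `0`. -/
theorem exists_TS_eq [Fintype X] {A B : X → ZMod 2} (hAB : A ≠ B) :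
    ∃ l : List X, (∀ x, A x + B x ≠ 0 → x ∈ x₀ :: l) ∧
      TS d x₀ A B = pathLength d (x₀ :: (l ++ [x₀])) + 1 := by
  obtain ⟨l, h1, h2⟩ := Nat.sInf_mem (s := {n : ℕ | ∃ l : List X,
    (∀ x, A x + B x ≠ 0 → x ∈ x₀ :: l) ∧ pathLength d (x₀ :: (l ++ [x₀])) = n})
    ⟨_, Finset.univ.toList, fun x _ => by simp, rfl⟩
  refine ⟨l, h1, ?_⟩
  rw [TS, if_neg hAB, h2]

theorem TSQuot_le {F : Submodule (ZMod 2) (X → ZMod 2)} (A B : X → ZMod 2) :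
    TSQuot d x₀ F (Submodule.Quotient.mk A) (Submodule.Quotient.mk B) ≤ TS d x₀ A B :=
  Nat.sInf_le ⟨A, B, rfl, rfl, rfl⟩

theorem exists_TSQuot_eq [Fintype X] {F : Submodule (ZMod 2) (X → ZMod 2)}
    {P Q : (X → ZMod 2) ⧸ F} (hPQ : P ≠ Q) :
    ∃ (A B : X → ZMod 2) (l : List X), Submodule.Quotient.mk A = P ∧ Submodule.Quotient.mk B = Q ∧
      (∀ x, A x + B x ≠ 0 → x ∈ x₀ :: l) ∧
      TSQuot d x₀ F P Q = pathLength d (x₀ :: (l ++ [x₀])) + 1 := by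
  obtain ⟨A₀, rfl⟩ := Submodule.Quotient.mk_surjective F P
  obtain ⟨B₀, rfl⟩ := Submodule.Quotient.mk_surjective F Q
  obtain ⟨A, B, h1, h2, h3⟩ := Nat.sInf_mem (s := {n : ℕ | ∃ A B : X → ZMod 2,
    (Submodule.Quotient.mk A : (X → ZMod 2) ⧸ F) = Submodule.Quotient.mk A₀ ∧
    (Submodule.Quotient.mk B : (X → ZMod 2) ⧸ F) = Submodule.Quotient.mk B₀ ∧ TS d x₀ A B = n})
    ⟨_, A₀, B₀, rfl, rfl, rfl⟩
  have hAB : A ≠ B := by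
    rintro rfl
    exact hPQ (h1.symm.trans h2)
  obtain ⟨l, h4, h5⟩ := exists_TS_eq (d := d) (x₀ := x₀) hAB
  exact ⟨A, B, l, h1, h2, h4, by rw [← h5, h3]; rfl⟩

end Metric

/-! ### The embedding at a single scale -/

section Embedding

variable {G : Type*} [Group G] [DecidableEq G] {S : Finset G} {I : Finset G}
  {ψ : (G →₀ ZMod 6) → ZMod 2} {V : Submodule (ZMod 2) (Wreath6 G →₀ ZMod 2)}
  {hV : RightInvariant V}

theorem exists_of_detect_ne_zero {P : Wreath6 G →₀ ZMod 2} {v : I → ZMod 6}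
    (h : detect I ψ P v ≠ 0) :
    ∃ k : Wreath6 G, P k ≠ 0 ∧ restrictTo I k.left = v ∧ ψ k.left ≠ 0 := by
  rw [detect, Finsupp.linearCombination_apply, Finsupp.sum, Finset.sum_apply] at h
  obtain ⟨k, hk, hne⟩ := Finset.exists_ne_zero_of_sum_ne_zero h
  refine ⟨k, Finsupp.mem_support_iff.1 hk, ?_⟩
  by_cases h1 : k.right = 1
  · rw [if_pos h1, Pi.smul_apply] at hne
    by_cases h2 : v = restrictTo I k.left
    · subst h2
      rw [Pi.single_eq_same] at hne
      exact ⟨rfl, fun h0 => hne (by rw [h0, smul_zero])⟩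
    · rw [Pi.single_eq_of_ne h2, smul_zero] at hne
      exact absurd rfl hne
  · rw [if_neg h1, smul_zero] at hne
    exact absurd rfl hne

/-- A shortest word produces an actual finitely supported representative `P` of the class of `P₀`.
Its image under the test differs from that of `P₀` by an element of `perp D`, and is supported on
the tour read off from the word. -/
theorem exists_tour_of_hasWord (hS : ∀ s ∈ S, s⁻¹ ∈ S)
    (hgen : Subgroup.closure (S : Set G) = ⊤) {r : ℝ} (hr : 0 < r)
    (hlen : ∀ x ∈ I, r ≤ (wordLength (S : Set G) x : ℝ))
    (hdist : ∀ x ∈ I, ∀ x' ∈ I, x ≠ x' → r ≤ (rightWordDist (S : Set G) x x' : ℝ)) {m : ℕ}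
    (hψ : ∀ w, ψ w ≠ 0 → ∃ x, w x ≠ 0 ∧ m ≤ wordLength (S : Set G) x)
    {D : Submodule (ZMod 2) ((I → ZMod 6) → ZMod 2)}
    (hD : ∀ P ∈ V, detect I ψ P ∈ perp D) {P₀ : Wreath6 G →₀ ZMod 2}
    (hP₀ : detect I ψ P₀ ∉ perp D) {n : ℕ}
    (hword : HasWord (quotientWreathGenerators V hV (wreathGenerators (S : Set G)))
      (⟨Submodule.Quotient.mk P₀, 1⟩ : QuotientWreath V hV) n) :
    ∃ (W : (I → ZMod 6) → ZMod 2) (l : List (I → ZMod 6)),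
      W - detect I ψ P₀ ∈ perp D ∧ (∀ v, W v ≠ 0 → v ∈ 0 :: l) ∧
      r * pathLength hammingSix (0 :: (l ++ [0])) ≤ 3 * r + 9 *
        wordLength (quotientWreathGenerators V hV (wreathGenerators (S : Set G)))
          (⟨Submodule.Quotient.mk P₀, 1⟩ : QuotientWreath V hV) ∧
      m ≤ wordLength (quotientWreathGenerators V hV (wreathGenerators (S : Set G)))
          (⟨Submodule.Quotient.mk P₀, 1⟩ : QuotientWreath V hV) := by
  obtain ⟨l, hl, hprod, hlength⟩ := hword.exists_list
  obtain ⟨P, z, v₀, p, h1, -, -, h4, h5, -, h7, -, h9⟩ :=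
    exists_walk_of_word hS hgen hr hlen hdist l hl
  rw [← hlength]
  rw [hprod] at h1 h7 h9
  have hdiff : detect I ψ P - detect I ψ P₀ ∈ perp D := by
    rw [← map_sub]
    exact hD _ ((Submodule.Quotient.eq V).1 h1)
  have hne : detect I ψ P ≠ 0 := by
    intro h0
    rw [h0, zero_sub] at hdiff
    exact hP₀ (by simpa using Submodule.neg_mem _ hdiff)
  refine ⟨detect I ψ P, v₀ :: p, hdiff, ?_, ?_, ?_⟩
  · intro v hv
    obtain ⟨k, hk, rfl, -⟩ := exists_of_detect_ne_zero hv
    have := h5 k hk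
    simp only [List.mem_cons, List.mem_append, List.not_mem_nil, or_false] at this ⊢
    tauto
  -- The word ends with all inner lamps off, so `v₀` vanishes off `z`. Joining `0` to it accounts
  -- for the term `3 * r`.
  · have h3 : hammingSix 0 v₀ ≤ 3 := hammingSix_le_three (z := z) fun x hx => h7 x hx
    have h3' : (hammingSix 0 v₀ : ℝ) ≤ 3 := by exact_mod_cast h3
    have hpl : pathLength hammingSix (0 :: (v₀ :: p ++ [0])) =
        hammingSix 0 v₀ + pathLength hammingSix (v₀ :: (p ++ [0])) := rfl
    rw [hpl]
    push_cast
    have := mul_le_mul_of_nonneg_left h3' hr.le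
    have h0 : (0 : ℝ) ≤ rightWordDist (S : Set G) z (1 : G) := Nat.cast_nonneg _
    change r * _ + 9 * (rightWordDist (S : Set G) z (1 : G) : ℝ) ≤ _ at h9
    linarith
  · obtain ⟨v, hv⟩ := Function.ne_iff.1 hne
    obtain ⟨k, hk, -, hψk⟩ := exists_of_detect_ne_zero hv
    obtain ⟨x, hx, hmx⟩ := hψ _ hψk
    exact hmx.trans (h4 k hk x hx)

/-- The embedding at a single scale. -/
theorem exists_embedding (hS : ∀ s ∈ S, s⁻¹ ∈ S) (hgen : Subgroup.closure (S : Set G) = ⊤)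
    {r M : ℝ} (hr : 24 ≤ r) (hM : 1 ≤ M)
    (hlen : ∀ x ∈ I, r ≤ (wordLength (S : Set G) x : ℝ))
    (hlen' : ∀ x ∈ I, (wordLength (S : Set G) x : ℝ) ≤ 2 * M * r)
    (hdist : ∀ x ∈ I, ∀ x' ∈ I, x ≠ x' → r ≤ (rightWordDist (S : Set G) x x' : ℝ))
    {L : Finset G} {y c : G} (hL : (configurationCost S L : ℝ) ≤ r)
    (hc : (wordLength (S : Set G) c : ℝ) < r) (hc' : r - 1 ≤ (wordLength (S : Set G) c : ℝ))
    (hψ : ∀ w, ψ w ≠ 0 → ∃ x, w x ≠ 0 ∧ wordLength (S : Set G) c ≤ wordLength (S : Set G) x)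
    {D : Submodule (ZMod 2) ((I → ZMod 6) → ZMod 2)}
    (hD : ∀ P ∈ V, detect I ψ P ∈ perp D) (hDV : ∀ W ∈ perp D, lampSum L I y W ∈ V)
    (hyc : ∀ W, lampSum L I y W - lampSum L I c W ∈ V)
    (hdet : ∀ W, detect I ψ (lampSum L I y W) = W)
    (h0 : (Pi.single 0 1 : (I → ZMod 6) → ZMod 2) ∉ perp D) :
    ∃ ψ₀ : ((I → ZMod 6) → ZMod 2) →ₗ[ZMod 2] ((Wreath6 G →₀ ZMod 2) ⧸ V),
      (∀ W, ψ₀ W = Submodule.Quotient.mk (lampSum L I y W)) ∧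
      LinearMap.ker ψ₀ = perp D ∧
      ∃ ψ : (((I → ZMod 6) → ZMod 2) ⧸ perp D) → QuotientWreath V hV,
        (∀ W, ψ (Submodule.Quotient.mk W) = ⟨ψ₀ W, 1⟩) ∧
        Function.Injective ψ ∧
        distortion (TSQuot hammingSix 0 (perp D))
            (leftWordDist (quotientWreathGenerators V hV (wreathGenerators (S : Set G)))) ψ
          ≤ ENNReal.ofReal (442 * M) ∧
        expansionRatio (TSQuot hammingSix 0 (perp D))
            (leftWordDist (quotientWreathGenerators V hV (wreathGenerators (S : Set G)))) ψ
          ≤ ENNReal.ofReal (442 * r) := by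
  have hr0 : 0 < r := by linarith
  let ψ₀ : ((I → ZMod 6) → ZMod 2) →ₗ[ZMod 2] ((Wreath6 G →₀ ZMod 2) ⧸ V) :=
    V.mkQ ∘ₗ lampSum L I y
  have hψ₀ : ∀ W, ψ₀ W = Submodule.Quotient.mk (lampSum L I y W) := fun W => rfl
  have hψ₀' : ∀ W, ψ₀ W = Submodule.Quotient.mk (lampSum L I c W) := fun W =>
    (Submodule.Quotient.eq V).2 (hyc W)
  have hker : LinearMap.ker ψ₀ = perp D := by
    ext W
    rw [LinearMap.mem_ker, hψ₀, Submodule.Quotient.mk_eq_zero]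
    exact ⟨fun h => hdet W ▸ hD _ h, hDV W⟩
  let φ := (perp D).liftQ ψ₀ hker.ge
  have hφ : Function.Injective φ := LinearMap.ker_eq_bot.1 (Submodule.ker_liftQ_eq_bot _ _ _ hker.le)
  let f : (((I → ZMod 6) → ZMod 2) ⧸ perp D) → QuotientWreath V hV := fun p => ⟨φ p, 1⟩
  have hf : ∀ W, f (Submodule.Quotient.mk W) = ⟨ψ₀ W, 1⟩ := fun W => rfl
  have hinj : Function.Injective f := fun p q h => hφ (congrArg RightSemidirect.left h)
  set gens := quotientWreathGenerators V hV (wreathGenerators (S : Set G)) with hgens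
  have hθ : ∀ A B : (I → ZMod 6) → ZMod 2, leftWordDist gens (f (Submodule.Quotient.mk A))
      (f (Submodule.Quotient.mk B)) = wordLength gens (⟨ψ₀ (A + B), 1⟩ : QuotientWreath V hV) := by
    intro A B
    rw [leftWordDist, hf, hf, quotient_inv_mul, ← map_sub]
    have : B - A = A + B := by
      rw [CharTwo.sub_eq_add, add_comm]
    rw [this]
  set cP := 16 * wordLength (S : Set G) c + 24 + 4 * configurationCost S L with hcP
  set cM := 2 * ⌊2 * M * r⌋₊ + 1 with hcM
  have hMr : 0 ≤ 2 * M * r := by positivity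
  have hMr' : r ≤ M * r := by nlinarith
  -- Here `21 = 16 + 1 + 4`, from `|c| < r`, `24 ≤ r` and the bound on the cost of the earlier
  -- scales.
  have hcP' : (cP : ℝ) ≤ 21 * r := by
    rw [hcP]; push_cast; linarith
  have hcM' : (cM : ℝ) ≤ 5 * (M * r) := by
    have := Nat.floor_le hMr
    rw [hcM]; push_cast; linarith
  have hword : ∀ (W : (I → ZMod 6) → ZMod 2) (l : List (I → ZMod 6)),
      (∀ v, W v ≠ 0 → v ∈ 0 :: l) → HasWord gens (⟨ψ₀ W, 1⟩ : QuotientWreath V hV)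
        (cP + (cP + cM) * pathLength hammingSix (0 :: (l ++ [0]))) := by
    intro W l hl
    rw [hψ₀']
    exact hasWord_lampSum hS hgen (hasWord_wordLength hS hgen c)
      (fun x hx => (hasWord_wordLength hS hgen x).mono (Nat.le_floor (hlen' x hx))) hl
  have hupper : ∀ p q, p ≠ q → (leftWordDist gens (f p) (f q) : ℝ) ≤
      26 * (M * r) * TSQuot hammingSix 0 (perp D) p q := by
    intro p q hpq
    obtain ⟨A, B, l, rfl, rfl, h1, h2⟩ :=
      exists_TSQuot_eq (d := hammingSix) (x₀ := (0 : I → ZMod 6)) hpq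
    rw [h2, hθ]
    have h3 := (hword (A + B) l h1).wordLength_le
    have h4 : (wordLength gens (⟨ψ₀ (A + B), 1⟩ : QuotientWreath V hV) : ℝ) ≤
        cP + (cP + cM) * pathLength hammingSix (0 :: (l ++ [0])) := by exact_mod_cast h3
    have h5 : (0 : ℝ) ≤ pathLength hammingSix (0 :: (l ++ [(0 : I → ZMod 6)])) := Nat.cast_nonneg _
    have h6 : (cP : ℝ) + cM ≤ 26 * (M * r) := by linarith
    have h7 := mul_le_mul_of_nonneg_right h6 h5
    push_cast
    linarith
  -- For word length `ℓ`, the tour gives `r * TSQuot ≤ 4 * r + 9 * ℓ`. Since `24 ≤ r ≤ ℓ + 1`, also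
  -- `4 * r ≤ 8 * ℓ`, whence `17`.
  have hlower : ∀ p q, p ≠ q → (TSQuot hammingSix 0 (perp D) p q : ℝ) ≤
      17 / r * leftWordDist gens (f p) (f q) := by
    intro p q hpq
    obtain ⟨A, rfl⟩ := Submodule.Quotient.mk_surjective _ p
    obtain ⟨B, rfl⟩ := Submodule.Quotient.mk_surjective _ q
    have hAB : detect I ψ (lampSum L I y (A + B)) ∉ perp D := by
      rw [hdet]
      intro h
      refine hpq ((Submodule.Quotient.eq _).2 ?_)
      rwa [CharTwo.sub_eq_add]
    -- The tour through all configurations only serves to show that some word exists.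
    have hw := hword (A + B) Finset.univ.toList (by simp)
    rw [hψ₀] at hw
    obtain ⟨W, l, h1, h2, h3, h4⟩ :=
      exists_tour_of_hasWord hS hgen hr0 hlen hdist hψ hD hAB hw
    rw [hθ, hψ₀]
    rw [hdet] at h1
    have h5 : (Submodule.Quotient.mk A : ((I → ZMod 6) → ZMod 2) ⧸ perp D) =
        Submodule.Quotient.mk (W + B) := by
      rw [Submodule.Quotient.eq]
      have : A - (W + B) = -(W - (A + B)) - (B + B) := by abel
      rw [this, CharTwo.add_self_eq_zero, sub_zero]
      exact Submodule.neg_mem _ h1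
    have h6 : TSQuot hammingSix 0 (perp D) (Submodule.Quotient.mk A) (Submodule.Quotient.mk B) ≤
        pathLength hammingSix (0 :: (l ++ [0])) + 1 := by
      rw [h5]
      refine (TSQuot_le _ _).trans (TS_le fun v hv => h2 v fun h => hv ?_)
      rw [Pi.add_apply, h, zero_add, CharTwo.add_self_eq_zero]
    have h6' : (TSQuot hammingSix 0 (perp D) (Submodule.Quotient.mk A)
        (Submodule.Quotient.mk B) : ℝ) ≤ pathLength hammingSix (0 :: (l ++ [0])) + 1 := by
      exact_mod_cast h6
    rw [div_mul_eq_mul_div, le_div_iff₀ hr0]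
    have h7 := mul_le_mul_of_nonneg_left h6' hr0.le
    have h4' : (wordLength (S : Set G) c : ℝ) ≤ wordLength gens
        (⟨Submodule.Quotient.mk (lampSum L I y (A + B)), 1⟩ : QuotientWreath V hV) := by
      exact_mod_cast h4
    linarith
  refine ⟨ψ₀, hψ₀, hker, f, hf, hinj, ?_, ?_⟩
  · have hconst : 442 * M = 26 * (M * r) * (17 / r) := by
      field_simp
      norm_num
    rw [hconst]
    exact distortion_le (by positivity) (by positivity) hinj hupper hlower
  · have hne : (Submodule.Quotient.mk (Pi.single 0 1) : ((I → ZMod 6) → ZMod 2) ⧸ perp D) ≠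
        Submodule.Quotient.mk 0 := by
      rw [ne_eq, Submodule.Quotient.eq, sub_zero]
      exact h0
    -- The point mass at `0` needs no moves on `I`: its image is a single block of cost `cP`,
    -- without the factor `M`, while its distance from `0` is at least `1`.
    refine (expansionRatio_le (α := 21 * r) (by positivity) hne ?_).trans
      (ENNReal.ofReal_le_ofReal (by linarith))
    obtain ⟨-, -, l, -, -, -, h2⟩ :=
      exists_TSQuot_eq (d := hammingSix) (x₀ := (0 : I → ZMod 6)) hne
    rw [h2, hθ, add_zero]
    have h3 := (hword (Pi.single 0 1) [] fun v hv => by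
      by_contra h
      rw [Pi.single_eq_of_ne (by simpa using h)] at hv
      exact hv rfl).wordLength_le
    have hpl : pathLength hammingSix (0 :: ([] ++ [(0 : I → ZMod 6)])) = 0 := by
      simp [pathLength, hammingSix]
    rw [hpl, mul_zero, add_zero] at h3
    have h3' : (wordLength gens (⟨ψ₀ (Pi.single 0 1), 1⟩ : QuotientWreath V hV) : ℝ) ≤ cP := by
      exact_mod_cast h3
    have h5 : (0 : ℝ) ≤ pathLength hammingSix (0 :: (l ++ [(0 : I → ZMod 6)])) := Nat.cast_nonneg _
    push_cast
    nlinarith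

end Embedding

/-- Otherwise translation invariance puts the point mass at a basis vector `e_x` into `perp D`, and
hence the indicator of `x` into `perp C`. It is not orthogonal to the all-ones vector. -/
theorem single_zero_notMem_perp {G : Type*} [DecidableEq G] {I : Finset G}
    {C : Submodule (ZMod 2) (I → ZMod 2)}
    {D : Submodule (ZMod 2) ((I → ZMod 6) → ZMod 2)} (hI : I.Nonempty) (hC : (fun _ => 1) ∈ C)
    (hD : TranslationInvariant D) (hCD : ExtendsCode C D) :
    (Pi.single 0 1 : (I → ZMod 6) → ZMod 2) ∉ perp D := by
  obtain ⟨x, hx⟩ := hI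
  have hinj : ∀ a : I, (Pi.single a 1 : I → ZMod 6) = Pi.single ⟨x, hx⟩ 1 → a = ⟨x, hx⟩ := by
    intro a h
    by_contra hne
    have := congrFun h a
    rw [Pi.single_eq_same, Pi.single_eq_of_ne hne] at this
    exact absurd this (by decide)
  intro h0
  have h1 : (Pi.single (Pi.single (⟨x, hx⟩ : I) 1) 1 : (I → ZMod 6) → ZMod 2) ∈ perp D := by
    intro d hd
    have := h0 _ (hD (-Pi.single ⟨x, hx⟩ 1) d hd)
    rw [Finset.sum_eq_single 0] at this
    · rw [Finset.sum_eq_single (Pi.single ⟨x, hx⟩ 1)]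
      · simpa using this
      · intro v _ hv
        rw [Pi.single_eq_of_ne hv, zero_mul]
      · simp
    · intro v _ hv
      rw [Pi.single_eq_of_ne hv, zero_mul]
    · simp
  have h2 := (hCD _ fun w hw => ⟨⟨x, hx⟩, by
    by_contra h
    exact hw (Pi.single_eq_of_ne h _)⟩).1 h1 _ hC
  rw [Finset.sum_eq_single ⟨x, hx⟩] at h2
  · simp at h2
  · intro a _ ha
    beta_reduce
    rw [Pi.single_eq_of_ne fun h => ha (hinj a h), zero_mul]
  · simp

/-! ### Growth of the scales -/

section Growth

variable {G : Type*} [Group G] [DecidableEq G] {S : Finset G}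

/-- A growth rate of the scales: each scale has to exceed the radius of a ball that contains all
sets of the scales before, and the costs of all lamp configurations on subsets of that ball. -/
noncomputable def growthRate (hS : ∀ s ∈ S, s⁻¹ ∈ S)
    (hgen : Subgroup.closure (S : Set G) = ⊤) (M t : ℝ) : ℝ :=
  24 + 2 * M * |t| +
    ((∑ E ∈ (finite_ball hS hgen ⌊2 * M * t⌋₊).toFinset.powerset, configurationCost S E : ℕ) : ℝ)

theorem configurationCost_le_growthRate (hS : ∀ s ∈ S, s⁻¹ ∈ S)
    (hgen : Subgroup.closure (S : Set G) = ⊤) {M t : ℝ} (hM : 0 ≤ M) {E : Finset G}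
    (hE : ∀ x ∈ E, (wordLength (S : Set G) x : ℝ) ≤ 2 * M * t) :
    (configurationCost S E : ℝ) ≤ growthRate hS hgen M t := by
  have h1 : configurationCost S E ≤
      ∑ E ∈ (finite_ball hS hgen ⌊2 * M * t⌋₊).toFinset.powerset, configurationCost S E := by
    refine Finset.single_le_sum (f := fun E => configurationCost S E) (fun _ _ => Nat.zero_le _) ?_
    rw [Finset.mem_powerset]
    intro x hx
    rw [Set.Finite.mem_toFinset]
    exact Nat.le_floor (hE x hx)
  have h2 : (configurationCost S E : ℝ) ≤
      ((∑ E ∈ (finite_ball hS hgen ⌊2 * M * t⌋₊).toFinset.powerset,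
        configurationCost S E : ℕ) : ℝ) := by exact_mod_cast h1
  have h3 : 0 ≤ 2 * M * |t| := by positivity
  rw [growthRate]
  linarith

theorem le_growthRate (hS : ∀ s ∈ S, s⁻¹ ∈ S) (hgen : Subgroup.closure (S : Set G) = ⊤)
    (M t : ℝ) : 24 + 2 * M * |t| ≤ growthRate hS hgen M t :=
  le_add_of_nonneg_right (Nat.cast_nonneg _)

end Growth

/-! ### Elementary properties of scale data -/

section ScaleData

variable {G : Type*} [Group G] {S : Set G} {M : ℝ} {r : ℕ → ℝ} {I : ℕ → Finset G} {y : ℕ → G}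

namespace IsScaleData

theorem strictMono (h : IsScaleData S M r I y) : StrictMono r :=
  strictMono_nat_of_lt_succ fun n => (h.lt_y n).trans (h.y_lt n)

theorem r_pos (h : IsScaleData S M r I y) (n : ℕ) : 0 < r n :=
  h.pos.trans_le (h.strictMono.monotone (Nat.zero_le n))

theorem wordLength_y_lt (h : IsScaleData S M r I y) {m n : ℕ} (hmn : m < n) :
    (wordLength S (y m) : ℝ) < wordLength S (y n) :=
  (h.y_lt m).trans_le ((h.strictMono.monotone hmn).trans (h.lt_y n).le)

theorem y_injective (h : IsScaleData S M r I y) : Function.Injective y := by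
  intro m n hmn
  rcases lt_trichotomy m n with hlt | heq | hlt
  · have := h.wordLength_y_lt hlt
    rw [hmn] at this
    exact absurd this (lt_irrefl _)
  · exact heq
  · have := h.wordLength_y_lt hlt
    rw [hmn] at this
    exact absurd this (lt_irrefl _)

theorem nonempty (h : IsScaleData S M r I y) (n : ℕ) : (I n).Nonempty := by
  rw [← Finset.card_pos]
  have : (0 : ℝ) < (I n).card := by
    rw [h.card]
    exact Real.rpow_pos_of_pos (by norm_num) _
  exact_mod_cast this

theorem wordLength_le_of_scale (h : IsScaleData S M r I y) (hM : 1 ≤ M) {k : ℕ} {x : G}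
    (hx : x = y k ∨ x ∈ I k) :
    (wordLength S x : ℝ) ≤ 2 * M * wordLength S (y k) := by
  have hr := h.r_pos k
  have hlt := h.lt_y k
  rcases hx with rfl | hx
  · nlinarith
  · exact (h.length_le k x hx).trans (by gcongr)

variable [DecidableEq G]

theorem disjoint_lowerSet (h : IsScaleData S M r I y) (n : ℕ) :
    Disjoint (lowerSet I y n) (I n) := by
  rw [Finset.disjoint_left]
  intro x hx hxn
  obtain ⟨k, hk, rfl | hxk⟩ := mem_lowerSet.1 hx
  · exact h.y_notMem k n hxn
  · exact Finset.disjoint_left.1 (h.disj k n hk.ne) hxk hxn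

theorem y_notMem_lowerSet (h : IsScaleData S M r I y) (n : ℕ) : y n ∉ lowerSet I y n := by
  intro hy
  obtain ⟨k, hk, hyk | hyk⟩ := mem_lowerSet.1 hy
  · exact hk.ne (h.y_injective hyk).symm
  · exact h.y_notMem n k hyk

end IsScaleData

end ScaleData

/-! ### Anchors -/

section Anchors

variable {G : Type*} [Group G] [DecidableEq G] {S : Finset G} {M : ℝ} {r : ℕ → ℝ}
  {I : ℕ → Finset G} {y : ℕ → G}

/-- All sets of the scales up to `n` lie in the ball of radius `2 * M * |y n|`, over whose subsets
the growth rate sums the costs. -/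
theorem configurationCost_lowerSet_le (hS : ∀ s ∈ S, s⁻¹ ∈ S)
    (hgen : Subgroup.closure (S : Set G) = ⊤) (hM : 1 ≤ M)
    (h : IsScaleData (S : Set G) M r I y)
    (hF : ScalesGrow (S : Set G) (growthRate hS hgen M) r y) (n : ℕ) :
    (configurationCost S (lowerSet I y n) : ℝ) ≤ r n := by
  cases n with
  | zero =>
    refine (configurationCost_le_growthRate hS hgen (by linarith) ?_).trans hF.1
    intro x hx
    obtain ⟨k, hk, -⟩ := mem_lowerSet.1 hx
    exact absurd hk (Nat.not_lt_zero k)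
  | succ n =>
    refine (configurationCost_le_growthRate hS hgen (by linarith) ?_).trans (hF.2.2 n)
    intro x hx
    obtain ⟨k, hk, hxk⟩ := mem_lowerSet.1 hx
    refine (h.wordLength_le_of_scale hM hxk).trans ?_
    have : (wordLength (S : Set G) (y k) : ℝ) ≤ wordLength (S : Set G) (y n) := by
      rcases (Nat.lt_succ_iff.1 hk).lt_or_eq with hlt | rfl
      · exact (h.wordLength_y_lt hlt).le
      · exact le_rfl
    gcongr

/-- Points at distance about `r n` from `1` that avoid the sets of all scales. -/
theorem exists_anchors (hS : ∀ s ∈ S, s⁻¹ ∈ S) (hgen : Subgroup.closure (S : Set G) = ⊤)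
    (hM : 1 ≤ M) (h : IsScaleData (S : Set G) M r I y)
    (hF : ScalesGrow (S : Set G) (growthRate hS hgen M) r y) :
    (∀ n, 24 ≤ r n) ∧ ∃ c : ℕ → G,
      (∀ n, (wordLength (S : Set G) (c n) : ℝ) < r n) ∧
      (∀ n, r n - 1 ≤ (wordLength (S : Set G) (c n) : ℝ)) ∧
      (∀ m n, c m ∉ I n) ∧ (∀ m n, c m ≠ y n) ∧ Function.Injective c := by
  have h0 : 24 ≤ r 0 := by
    have h1 := (le_growthRate hS hgen M 0).trans hF.1
    rw [abs_zero, mul_zero, add_zero] at h1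
    exact h1
  have hr : ∀ n, 24 ≤ r n := fun n => h0.trans (h.strictMono.monotone (Nat.zero_le n))
  have hgrow : ∀ {k n : ℕ}, k < n →
      24 + 2 * M * (wordLength (S : Set G) (y k) : ℝ) ≤ r n := by
    intro k n hkn
    have h1 := (le_growthRate hS hgen M (wordLength (S : Set G) (y k))).trans (hF.2.2 k)
    rw [abs_of_nonneg (Nat.cast_nonneg _)] at h1
    exact h1.trans (h.strictMono.monotone hkn)
  -- The largest integer below `r n` is realized as a length because `y n` is longer.
  have hex : ∀ n, ∃ g : G, wordLength (S : Set G) g = ⌈r n⌉₊ - 1 := by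
    intro n
    refine exists_wordLength_eq hS hgen (y n) ?_
    have := Nat.ceil_le.2 (h.lt_y n).le
    omega
  choose c hc using hex
  have hceil : ∀ n, (wordLength (S : Set G) (c n) : ℝ) = ⌈r n⌉₊ - 1 := by
    intro n
    have h1 : 1 ≤ ⌈r n⌉₊ := Nat.one_le_ceil_iff.2 (h.r_pos n)
    rw [hc]
    push_cast [Nat.cast_sub h1]
    rfl
  have hlt : ∀ n, (wordLength (S : Set G) (c n) : ℝ) < r n := by
    intro n
    rw [hceil]
    have := Nat.ceil_lt_add_one (h.r_pos n).le
    linarith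
  have hge : ∀ n, r n - 1 ≤ (wordLength (S : Set G) (c n) : ℝ) := by
    intro n
    rw [hceil]
    have := Nat.le_ceil (r n)
    linarith
  -- Earlier scales have length at most `2 * M * |y k| ≤ r n - 24`, below that of `c n`. Scales from
  -- `n` on have length at least `r n`, above it.
  have hlow : ∀ {k n : ℕ}, k < n → ∀ x, (x = y k ∨ x ∈ I k) → c n ≠ x := by
    rintro k n hkn x hx rfl
    have h1 := h.wordLength_le_of_scale hM hx
    have h2 := hgrow hkn
    have h3 := hge n
    linarith
  refine ⟨hr, c, hlt, hge, ?_, ?_, ?_⟩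
  · intro m n hmem
    rcases lt_or_ge n m with hlt' | hle
    · exact hlow hlt' _ (Or.inr hmem) rfl
    · have h1 := h.le_length n _ hmem
      have h2 := h.strictMono.monotone hle
      have h3 := hlt m
      linarith
  · intro m n heq
    rcases lt_or_ge n m with hlt' | hle
    · exact hlow hlt' _ (Or.inl rfl) heq
    · have h1 := h.lt_y n
      have h2 := h.strictMono.monotone hle
      have h3 := hlt m
      rw [heq] at h3
      linarith
  · have hmono : StrictMono fun n => (wordLength (S : Set G) (c n) : ℝ) := by
      refine strictMono_nat_of_lt_succ fun n => ?_
      have h1 := hlt n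
      have h2 := hge (n + 1)
      have h3 := hgrow (Nat.lt_succ_self n)
      have h4 := h.lt_y n
      have h5 := h.r_pos n
      nlinarith
    intro m n hmn
    exact hmono.injective (by simp only [hmn])

end Anchors

/-! ### The embeddings at all scales -/

theorem mainTheorem3 :
    ∃ K : ℝ, 0 < K ∧
      ∀ (G : Type*) [Group G] [DecidableEq G] (S : Finset G),
        (∀ s ∈ S, s⁻¹ ∈ S) → Subgroup.closure (S : Set G) = ⊤ →
      ∀ M : ℝ, 1 ≤ M →
      ∃ F : ℝ → ℝ,
        ∀ (r : ℕ → ℝ) (I : ℕ → Finset G) (y : ℕ → G),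
          IsScaleData (S : Set G) M r I y → ScalesGrow (S : Set G) F r y →
        ∀ (C : ∀ n, Submodule (ZMod 2) (I n → ZMod 2))
          (D : ∀ n, Submodule (ZMod 2) ((I n → ZMod 6) → ZMod 2)),
          (∀ n, (fun _ => 1) ∈ C n) → (∀ n, TranslationInvariant (D n)) →
          (∀ n, ExtendsCode (C n) (D n)) →
        ∃ (V : Submodule (ZMod 2) (Wreath6 G →₀ ZMod 2)) (hV : RightInvariant V),
          ∀ n,
            ∃ ψ₀ : ((I n → ZMod 6) → ZMod 2) →ₗ[ZMod 2] ((Wreath6 G →₀ ZMod 2) ⧸ V),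
              (∀ W, ψ₀ W = Submodule.Quotient.mk (Qtilde I y n 0 W 0)) ∧
              LinearMap.ker ψ₀ = perp (D n) ∧
              ∃ ψ : (((I n → ZMod 6) → ZMod 2) ⧸ perp (D n)) → QuotientWreath V hV,
                (∀ W, ψ (Submodule.Quotient.mk W) = ⟨ψ₀ W, 1⟩) ∧
                Function.Injective ψ ∧
                distortion (TSQuot hammingSix 0 (perp (D n)))
                    (leftWordDist
                      (quotientWreathGenerators V hV (wreathGenerators (S : Set G)))) ψ
                  ≤ ENNReal.ofReal (K * M) ∧
                expansionRatio (TSQuot hammingSix 0 (perp (D n)))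
                    (leftWordDist
                      (quotientWreathGenerators V hV (wreathGenerators (S : Set G)))) ψ
                  ≤ ENNReal.ofReal (K * r n) := by
  refine ⟨442, by norm_num, ?_⟩
  intro G _ _ S hS hgen M hM
  refine ⟨growthRate hS hgen M, ?_⟩
  intro r I y hdata hF C D hC hD hCD
  obtain ⟨hr, c, hlt, hge, hcI, hcy, hcinj⟩ := exists_anchors hS hgen hM hdata hF
  -- Both families enter `Y`, since the test of one scale has to annihilate the blocks of every
  -- other scale at `y m` as well as at `c m`.
  let Y : Set G := Set.range y ∪ Set.range c
  let ψ : ℕ → (G →₀ ZMod 6) → ZMod 2 := fun n => profile (I n) (y n) (c n) Y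
  have hlower : ∀ n, c n ∉ lowerSet I y n := by
    intro n hn
    obtain ⟨k, -, hk | hk⟩ := mem_lowerSet.1 hn
    · exact hcy n k hk
    · exact hcI n k hk
  have hinv : ∀ n w v, ψ n (w + extendZero (I n) v) = ψ n w := fun n w v =>
    profile_add_extendZero (hdata.y_notMem n n) (hcI n n) w v
  have hswap : ∀ n w a, ψ n (w + Finsupp.single (y n) a) = ψ n (w + Finsupp.single (c n) a) :=
    fun n w a => profile_add_single w a
  have hzero_y : ∀ m n, m ≠ n → ∀ w, ∑ a ∈ supportA, ψ n (w + Finsupp.single (y m) a) = 0 :=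
    fun m n hmn w => sum_supportA_profile (hdata.y_notMem m n)
      (fun h => hmn (hdata.y_injective h)) (hcy n m).symm (Or.inl ⟨m, rfl⟩) w
  have hzero_c : ∀ m n, m ≠ n → ∀ w, ∑ a ∈ supportA, ψ n (w + Finsupp.single (c m) a) = 0 :=
    fun m n hmn w => sum_supportA_profile (hcI m n) (hcy m n)
      (fun h => hmn (hcinj h)) (Or.inr ⟨m, rfl⟩) w
  refine ⟨detectKernel I ψ D, detectKernel_rightInvariant I ψ D, fun n => ?_⟩
  simp only [Qtilde_eq_lampSum I y n _ (hdata.disjoint_lowerSet n) (hdata.y_notMem_lowerSet n)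
    (hdata.y_notMem n n)]
  refine exists_embedding (ψ := ψ n) (c := c n) hS hgen (hr n) hM (hdata.le_length n)
    (hdata.length_le n) (hdata.le_dist n) (configurationCost_lowerSet_le hS hgen hM hdata hF n)
    (hlt n) (hge n) ?_ (fun P hP => detect_mem_of_mem_detectKernel hP n) ?_ ?_ ?_
    (single_zero_notMem_perp (hdata.nonempty n) (hC n) (hD n) (hCD n))
  · intro w hw
    rcases ne_zero_of_profile_ne_zero hw with h | h
    · refine ⟨y n, h, ?_⟩
      have h1 := (hlt n).trans (hdata.lt_y n)
      exact_mod_cast h1.le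
    · exact ⟨c n, h, le_rfl⟩
  · intro W hW
    rw [mem_detectKernel]
    intro m k
    rcases eq_or_ne n m with rfl | hnm
    · exact detect_translate_lampSum_mem (hinv n) (hD n) hW k
    · rw [detect_translate_lampSum_eq_zero (hdata.y_notMem n m) (hzero_y n m hnm)]
      exact Submodule.zero_mem _
  -- The exchange of `y n` for `c n` is invisible to every test: to the test `n` by the symmetry of
  -- its weight, to the others because both terms vanish.
  · intro W
    rw [mem_detectKernel]
    intro m k
    rw [map_sub, map_sub]
    rcases eq_or_ne n m with rfl | hnm
    · rw [detect_translate_lampSum_eq (hdata.y_notMem n n) (hcI n n) (hswap n), sub_self]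
      exact Submodule.zero_mem _
    · rw [detect_translate_lampSum_eq_zero (hdata.y_notMem n m) (hzero_y n m hnm),
        detect_translate_lampSum_eq_zero (hcI n m) (hzero_c n m hnm), sub_zero]
      exact Submodule.zero_mem _
  · exact detect_lampSum_self (hdata.disjoint_lowerSet n) (hdata.y_notMem n n) (hinv n)
      (sum_profile (hdata.disjoint_lowerSet n) (hdata.y_notMem_lowerSet n) (hlower n)
        (hcy n n).symm)
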